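/- Let $W(I_2(4))\subset O_2$ be the dihedral group of order $8$ generated by the reflections in two lines of $\mathbb{R}^2$ meeting at angle $\pi/4$ (one of them a coordinate axis), let $H=W(I_2(4))\otimes W(I_2(4))\otimes W(I_2(4))\subset SO_8$ (acting on $\mathbb{R}^8=\mathbb{R}^2\otimes\mathbb{R}^2\otimes\mathbb{R}^2$), and let $N=N_{SO_8}(H)$ be its normalizer. View $A=H/\{\pm1\}$ as a vector space over $\mathbb{F}_2$ with the quadratic form $Q$ given by $Q(\{\pm h\})=0$ if $h^2=1$ and $Q(\{\pm h\})=1$ if $h^2=-1$. The group $N$ acts on $A$ by conjugation, which gives a homomorphism $N\to O(Q)$. Let $O^+(Q)$ be the set of all $u\in O(Q)$ with Dickson invariant $0$, i.e. for which the rank of $u-1$ is even. Let $\mathfrak{R}_2$ be the set of all $r\in SO_8$ of order $2$ whose $(-1)$-eigenspace is a nonzero weight space (simultaneous eigenspace) in $\mathbb{R}^8$ of the preimage in $H$ of some two-dimensional subspace of $A$ on which $Q$ vanishes identically. Then $O^+(Q)$ is a subgroup of $O(Q)$ isomorphic to $SL_4(2)$. Let $L$ be the preimage of $O^+(Q)$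 in $N$. The set $\mathfrak{R}_2$ has exactly $420$ elements, each of which is a rotation (its fixed point subspace has codimension two) of order $2$, and it generates $L$. In particular $L$ is a (finite) rotation group, i.e. a finite group generated by rotations. Moreover $L$ is primitive (that is, $\mathbb{R}^8$ is not a direct sum of proper nonzero subspaces that are permuted by $L$) and absolutely irreducible (its complexification, acting on $\mathbb{C}^8$, is irreducible). -/

import Mathlib

open scoped Kronecker Matrix

noncomputable section

namespace ExoticRotationGroup

/-! ### Finite rotation groups, primitivity, absolute irreducibility -/

section Linear

variable {ι : Type} [Fintype ι] [DecidableEq ι]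

/-- A rotation is an orthogonal transformation whose fixed point subspace has codimension two. -/
def IsRotation (g : Matrix.specialOrthogonalGroup ι ℝ) : Prop :=
  Module.finrank ℝ (Module.End.eigenspace (Matrix.toLin' (g : Matrix ι ι ℝ)) 1) + 2
    = Fintype.card ι

/-- A (finite) rotation group is a finite group generated by rotations. -/
def IsRotationGroup (G : Subgroup (Matrix.specialOrthogonalGroup ι ℝ)) : Prop :=
  Finite G ∧ Subgroup.closure {g | g ∈ G ∧ IsRotation g} = G

/-- `G` is imprimitive if the space is a direct sum of proper (nonzero) subspaces
`V 0, …, V (l - 1)` that are permuted by the elements of `G`. -/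
def IsImprimitive (G : Subgroup (Matrix.specialOrthogonalGroup ι ℝ)) : Prop :=
  ∃ (l : ℕ) (V : Fin l → Submodule ℝ (ι → ℝ)),
    DirectSum.IsInternal V ∧ (∀ i, V i ≠ ⊥ ∧ V i ≠ ⊤) ∧
      ∀ g ∈ G, ∀ i, ∃ j, (V i).map (Matrix.toLin' (g : Matrix ι ι ℝ)) = V j

/-- A group is primitive if it is not imprimitive. -/
def IsPrimitive (G : Subgroup (Matrix.specialOrthogonalGroup ι ℝ)) : Prop :=
  ¬ IsImprimitive G

/-- The complexification of the natural representation of `G` on `ℝ ^ ι`: the same matrices,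
acting on `ℂ ^ ι`. -/
def complexification (G : Subgroup (Matrix.specialOrthogonalGroup ι ℝ)) :
    Representation ℂ G (ι → ℂ) where
  toFun g := Matrix.toLin' (((g : Matrix.specialOrthogonalGroup ι ℝ) : Matrix ι ι ℝ).map
    (algebraMap ℝ ℂ))
  map_one' := by simp [Module.End.one_eq_id]
  map_mul' g h := by
    rw [Module.End.mul_eq_comp, ← Matrix.toLin'_mul, ← Matrix.map_mul]
    rfl

/-- `G` is absolutely irreducible if its complexification is irreducible. -/
def IsAbsolutelyIrreducible (G : Subgroup (Matrix.specialOrthogonalGroup ι ℝ)) : Prop :=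
  (complexification G).IsIrreducible

end Linear

/-! ### The orthogonal group of a quadratic form and the Dickson invariant -/

section Dickson

variable {K V : Type*} [Field K] [AddCommGroup V] [Module K V]

/-- The orthogonal group `O(Q)` of a quadratic form. -/
def orthogonalGroup (Q : QuadraticForm K V) : Subgroup (V ≃ₗ[K] V) where
  carrier := {u | ∀ x, Q (u x) = Q x}
  one_mem' _ := rfl
  mul_mem' {u v} hu hv x := (hu (v x)).trans (hv x)
  inv_mem' {u} hu x := by
    have h := hu (u⁻¹ x)
    rw [← h]
    exact congrArg Q (u.apply_symm_apply x)

/-- The Dickson invariant of an element `u` of the orthogonal group of a nondegenerate quadratic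
form on a finite-dimensional space: the rank of `u - 1` modulo `2`. -/
def dicksonInvariant {Q : QuadraticForm K V} (u : orthogonalGroup Q) : ZMod 2 :=
  (Module.finrank K (LinearMap.range ((u : V ≃ₗ[K] V).toLinearMap - LinearMap.id)) : ZMod 2)

end Dickson

/-! ### The groups `W(I₂(4))`, `H` and `N` -/

/-- The reflection in the line spanned by the first basis vector of `ℝ²`. -/
def reflection₁ : Matrix.orthogonalGroup (Fin 2) ℝ :=
  ⟨!![1, 0; 0, -1], by
    rw [Matrix.mem_orthogonalGroup_iff]
    ext i j; fin_cases i <;> fin_cases j <;> simp [Matrix.mul_apply]⟩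

/-- The reflection in the line spanned by the sum of the two basis vectors of `ℝ²`. -/
def reflection₂ : Matrix.orthogonalGroup (Fin 2) ℝ :=
  ⟨!![0, 1; 1, 0], by
    rw [Matrix.mem_orthogonalGroup_iff]
    ext i j; fin_cases i <;> fin_cases j <;> simp [Matrix.mul_apply]⟩

/-- The reflection group `W(I₂(4))`, dihedral of order `8`: it is generated by the reflections in
two lines that meet at an angle of `π / 4`. -/
def W : Subgroup (Matrix.orthogonalGroup (Fin 2) ℝ) :=
  Subgroup.closure {reflection₁, reflection₂}

/-- Index set of the basis `e i ⊗ e j ⊗ e k` of `ℝ⁸ = ℝ² ⊗ ℝ² ⊗ ℝ²`. -/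
abbrev Idx : Type := Fin 2 × Fin 2 × Fin 2

/-- The group `SO₈`. -/
abbrev SO8 : Type := Matrix.specialOrthogonalGroup Idx ℝ

/-- The group `H = W(I₂(4)) ⊗ W(I₂(4)) ⊗ W(I₂(4))` in `SO₈`. -/
def H : Subgroup SO8 where
  carrier := {g | ∃ a ∈ W, ∃ b ∈ W, ∃ c ∈ W,
    (g : Matrix Idx Idx ℝ) = (a : Matrix (Fin 2) (Fin 2) ℝ) ⊗ₖ
      ((b : Matrix (Fin 2) (Fin 2) ℝ) ⊗ₖ (c : Matrix (Fin 2) (Fin 2) ℝ))}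
  one_mem' := ⟨1, W.one_mem, 1, W.one_mem, 1, W.one_mem, by simp⟩
  mul_mem' := by
    rintro g h ⟨a, ha, b, hb, c, hc, e⟩ ⟨a', ha', b', hb', c', hc', e'⟩
    refine ⟨a * a', W.mul_mem ha ha', b * b', W.mul_mem hb hb', c * c', W.mul_mem hc hc', ?_⟩
    have : ((g * h : SO8) : Matrix Idx Idx ℝ) = (g : Matrix Idx Idx ℝ) * h := rfl
    rw [this, e, e', ← Matrix.mul_kronecker_mul, ← Matrix.mul_kronecker_mul]
    rfl
  inv_mem' := by
    rintro g ⟨a, ha, b, hb, c, hc, e⟩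
    refine ⟨a⁻¹, W.inv_mem ha, b⁻¹, W.inv_mem hb, c⁻¹, W.inv_mem hc, ?_⟩
    have : ((g⁻¹ : SO8) : Matrix Idx Idx ℝ) = (g : Matrix Idx Idx ℝ)ᴴ := rfl
    rw [this, e, Matrix.conjTranspose_kronecker, Matrix.conjTranspose_kronecker]
    rfl

/-- The normalizer `N` of `H` in `SO₈`. -/
abbrev N : Subgroup SO8 := Subgroup.normalizer (H : Set SO8)

/-- The underlying matrix of an element of `H`. -/
def mat (h : H) : Matrix Idx Idx ℝ := ((h : SO8) : Matrix Idx Idx ℝ)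

theorem mat_one : mat 1 = 1 := rfl

theorem mat_mul (h k : H) : mat (h * k) = mat h * mat k := rfl

theorem mat_injective : Function.Injective mat := fun _ _ e => Subtype.ext (Subtype.ext e)

theorem neg_one_ne_one : (-1 : Matrix Idx Idx ℝ) ≠ 1 := by
  intro h
  have := congrFun (congrFun h 0) 0
  simp at this
  norm_num at this

theorem W_form {a : Matrix.orthogonalGroup (Fin 2) ℝ} (ha : a ∈ W) :
    ∃ s t : ℝ, (s = 1 ∨ s = -1) ∧ (t = 1 ∨ t = -1) ∧
      ((a : Matrix (Fin 2) (Fin 2) ℝ) = !![s, 0; 0, t] ∨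
        (a : Matrix (Fin 2) (Fin 2) ℝ) = !![0, s; t, 0]) := by
  induction ha using Subgroup.closure_induction with
  | mem x hx =>
    rcases hx with rfl | rfl
    · exact ⟨1, -1, by simp, by simp, Or.inl rfl⟩
    · exact ⟨1, 1, by simp, by simp, Or.inr rfl⟩
  | one => exact ⟨1, 1, by simp, by simp, Or.inl Matrix.one_fin_two⟩
  | mul x y _ _ hx hy =>
    obtain ⟨s, t, hs, ht, h⟩ := hx
    obtain ⟨s', t', hs', ht', h'⟩ := hy
    have e : ((x * y : Matrix.orthogonalGroup (Fin 2) ℝ) : Matrix (Fin 2) (Fin 2) ℝ) =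
      (x : Matrix (Fin 2) (Fin 2) ℝ) * y := rfl
    rw [e]
    rcases h with h | h <;> rcases h' with h' | h' <;> rw [h, h']
    · exact ⟨s * s', t * t', by grind, by grind, Or.inl (by simp)⟩
    · exact ⟨s * s', t * t', by grind, by grind, Or.inr (by simp)⟩
    · exact ⟨s * t', t * s', by grind, by grind, Or.inr (by simp)⟩
    · exact ⟨s * t', t * s', by grind, by grind, Or.inl (by simp)⟩
  | inv x _ hx =>
    obtain ⟨s, t, hs, ht, h⟩ := hx
    have e : ((x⁻¹ : Matrix.orthogonalGroup (Fin 2) ℝ) : Matrix (Fin 2) (Fin 2) ℝ) =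
      (x : Matrix (Fin 2) (Fin 2) ℝ)ᴴ := rfl
    rw [e]
    rcases h with h | h <;> rw [h]
    · exact ⟨s, t, hs, ht, Or.inl (by ext i j; fin_cases i <;> fin_cases j <;> simp)⟩
    · exact ⟨t, s, ht, hs, Or.inr (by ext i j; fin_cases i <;> fin_cases j <;> simp)⟩

theorem W_comm {a b : Matrix.orthogonalGroup (Fin 2) ℝ} (ha : a ∈ W) (hb : b ∈ W) :
    ∃ s : ℝ, (s = 1 ∨ s = -1) ∧ (a : Matrix (Fin 2) (Fin 2) ℝ) * (b : Matrix (Fin 2) (Fin 2) ℝ) =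
      s • ((b : Matrix (Fin 2) (Fin 2) ℝ) * (a : Matrix (Fin 2) (Fin 2) ℝ)) := by
  obtain ⟨s, t, hs, ht, h⟩ := W_form ha
  obtain ⟨s', t', hs', ht', h'⟩ := W_form hb
  by_cases hab : (a : Matrix (Fin 2) (Fin 2) ℝ) * (b : Matrix (Fin 2) (Fin 2) ℝ) =
    (b : Matrix (Fin 2) (Fin 2) ℝ) * (a : Matrix (Fin 2) (Fin 2) ℝ)
  · exact ⟨1, Or.inl rfl, by rw [hab, one_smul]⟩
  · refine ⟨-1, Or.inr rfl, ?_⟩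
    revert hab
    rcases h with h | h <;> rcases h' with h' | h' <;> rw [h, h'] <;>
    rcases hs with rfl | rfl <;> rcases ht with rfl | rfl <;>
    rcases hs' with rfl | rfl <;> rcases ht' with rfl | rfl <;> simp

theorem W_sq {a : Matrix.orthogonalGroup (Fin 2) ℝ} (ha : a ∈ W) :
    ∃ s : ℝ, (s = 1 ∨ s = -1) ∧ (a : Matrix (Fin 2) (Fin 2) ℝ) * (a : Matrix (Fin 2) (Fin 2) ℝ) =
      s • (1 : Matrix (Fin 2) (Fin 2) ℝ) := by
  obtain ⟨s, t, hs, ht, h⟩ := W_form ha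
  refine ⟨s * t * (if (a : Matrix (Fin 2) (Fin 2) ℝ) 0 0 = 0 then 1 else s * t),
    by split_ifs <;> grind, ?_⟩
  rcases h with h | h <;> rw [h] <;>
    rcases hs with rfl | rfl <;> rcases ht with rfl | rfl <;>
    (ext i j; fin_cases i <;> fin_cases j <;> simp)

/-- Two elements of `H` commute up to sign. -/
theorem H_comm (h k : H) : mat h * mat k = mat k * mat h ∨ mat h * mat k = -(mat k * mat h) := by
  obtain ⟨a, ha, b, hb, c, hc, e⟩ := h.2
  obtain ⟨a', ha', b', hb', c', hc', e'⟩ := k.2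
  obtain ⟨s, hs, es⟩ := W_comm ha ha'
  obtain ⟨t, ht, et⟩ := W_comm hb hb'
  obtain ⟨r, hr, er⟩ := W_comm hc hc'
  have : mat h * mat k = (s * t * r) • (mat k * mat h) := by
    unfold mat
    rw [e, e']
    simp only [← Matrix.mul_kronecker_mul, es, et, er, Matrix.smul_kronecker,
      Matrix.kronecker_smul, smul_smul]
    congr 1
    ring
  have hh : s * t * r = 1 ∨ s * t * r = -1 := by grind
  rcases hh with hh | hh <;> rw [hh] at this
  · left; simpa using this
  · right; simpa using this

/-- Elements of `H` square to `1` or `-1`. -/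
theorem H_sq (h : H) : mat h * mat h = 1 ∨ mat h * mat h = -1 := by
  obtain ⟨a, ha, b, hb, c, hc, e⟩ := h.2
  obtain ⟨s, hs, es⟩ := W_sq ha
  obtain ⟨t, ht, et⟩ := W_sq hb
  obtain ⟨r, hr, er⟩ := W_sq hc
  have : mat h * mat h = (s * t * r) • (1 : Matrix Idx Idx ℝ) := by
    unfold mat
    rw [e]
    simp only [← Matrix.mul_kronecker_mul, es, et, er, Matrix.smul_kronecker,
      Matrix.kronecker_smul, smul_smul, Matrix.one_kronecker_one]
    congr 1
    ring
  have hh : s * t * r = 1 ∨ s * t * r = -1 := by grind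
  rcases hh with hh | hh <;> rw [hh] at this
  · left; simpa using this
  · right; simpa using this

/-! ### The `𝔽₂`-vector space `H / {±1}` and its quadratic form -/

theorem mat_inv_mul_self (h : H) : mat h⁻¹ * mat h = 1 := by
  rw [← mat_mul, inv_mul_cancel, mat_one]

theorem mat_mul_inv_self (h : H) : mat h * mat h⁻¹ = 1 := by
  rw [← mat_mul, mul_inv_cancel, mat_one]

/-- The subgroup `{±1}` of `H`. -/
def signs : Subgroup H where
  carrier := {h | mat h = 1 ∨ mat h = -1}
  one_mem' := Or.inl rfl
  mul_mem' {h k} hh hk := by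
    change mat (h * k) = 1 ∨ mat (h * k) = -1
    rw [mat_mul]
    rcases hh with e | e <;> rcases hk with e' | e' <;> simp [e, e']
  inv_mem' {h} hh := by
    have := mat_inv_mul_self h
    change mat h⁻¹ = 1 ∨ mat h⁻¹ = -1
    rcases hh with e | e <;> rw [e] at this
    · left; simpa using this
    · right; rw [← this]; simp

theorem mem_signs {h : H} : h ∈ signs ↔ mat h = 1 ∨ mat h = -1 := Iff.rfl

instance : signs.Normal where
  conj_mem h hh g := by
    rw [mem_signs, mat_mul, mat_mul]
    rcases hh with e | e <;> simp [e, mat_mul_inv_self]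

instance : CommGroup (H ⧸ signs) where
  mul_comm x y := by
    induction x using QuotientGroup.induction_on with | H h => ?_
    induction y using QuotientGroup.induction_on with | H k => ?_
    rw [← QuotientGroup.mk_mul, ← QuotientGroup.mk_mul, QuotientGroup.eq, mem_signs]
    have hc : mat ((h * k)⁻¹ * (k * h)) = mat (h * k)⁻¹ * (mat k * mat h) := by
      rw [mat_mul, mat_mul k h]
    have hi := mat_inv_mul_self (h * k)
    rw [mat_mul h k] at hi
    rw [hc]
    rcases H_comm h k with e | e <;> rw [e] at hi
    · left; exact hi
    · right; rw [← hi]; simp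

/-- The space `A = H / {±1}`, written additively. -/
abbrev A : Type := Additive (H ⧸ signs)

/-- The class `{±h}` of `h` in `A`. -/
def cls (h : H) : A := Additive.ofMul (h : H ⧸ signs)

theorem cls_mul (h k : H) : cls (h * k) = cls h + cls k := rfl

theorem cls_one : cls 1 = 0 := rfl

theorem cls_surjective : Function.Surjective cls := fun x =>
  QuotientGroup.mk_surjective (Additive.toMul x)

theorem cls_inv (h : H) : cls h⁻¹ = - cls h := rfl

theorem cls_eq_zero {h : H} : cls h = 0 ↔ mat h = 1 ∨ mat h = -1 :=
  (QuotientGroup.eq_one_iff h).trans mem_signs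

theorem cls_eq {h k : H} : cls h = cls k ↔ mat h = mat k ∨ mat h = - mat k := by
  rw [← sub_eq_zero, sub_eq_add_neg, ← cls_inv, ← cls_mul, cls_eq_zero, mat_mul]
  constructor
  · rintro (e | e)
    · left
      have := congrArg (· * mat k) e
      simpa [Matrix.mul_assoc, mat_inv_mul_self] using this
    · right
      have := congrArg (· * mat k) e
      simpa [Matrix.mul_assoc, mat_inv_mul_self] using this
  · rintro (e | e) <;> simp [e, mat_mul_inv_self]

/-- `A` is an elementary abelian `2`-group, i.e. a vector space over `𝔽₂`. -/
instance : Module (ZMod 2) A := AddCommGroup.zmodModule (n := 2) (by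
  intro x
  obtain ⟨h, rfl⟩ := cls_surjective x
  rw [two_nsmul, ← cls_mul, cls_eq_zero, mat_mul]
  exact H_sq h)

open Classical in
/-- `0` if `M = 1`, and `1` otherwise; used for `M = ±1`. -/
def signExp (M : Matrix Idx Idx ℝ) : ZMod 2 := if M = 1 then 0 else 1

theorem signExp_one : signExp 1 = 0 := by simp [signExp]

theorem signExp_neg_one : signExp (-1) = 1 := by simp [signExp, neg_one_ne_one]

/-- The function `Q : A → 𝔽₂` with `Q({±h}) = 0` if `h² = 1` and `Q({±h}) = 1` if `h² = -1`. -/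
def qFun (x : A) : ZMod 2 :=
  signExp (mat (Function.surjInv cls_surjective x) * mat (Function.surjInv cls_surjective x))

theorem qFun_cls (h : H) : qFun (cls h) = signExp (mat h * mat h) := by
  unfold qFun
  rcases cls_eq.1 (Function.surjInv_eq cls_surjective (cls h)) with e | e <;> simp [e]

/-- `0` if `h` and `k` commute, `1` if they anticommute. -/
def commExp (h k : H) : ZMod 2 := qFun (cls h + cls k) - qFun (cls h) - qFun (cls k)

theorem commExp_of_comm {h k : H} (e : mat h * mat k = mat k * mat h) : commExp h k = 0 := by
  have h2 : mat (h * k) * mat (h * k) = (mat h * mat h) * (mat k * mat k) := by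
    rw [mat_mul]
    calc mat h * mat k * (mat h * mat k) = mat h * (mat k * mat h) * mat k := by
          simp only [Matrix.mul_assoc]
      _ = _ := by rw [← e]; simp only [Matrix.mul_assoc]
  unfold commExp
  rw [← cls_mul, qFun_cls, qFun_cls, qFun_cls, h2]
  rcases H_sq h with a | a <;> rcases H_sq k with b | b <;>
    simp [a, b, signExp_one, signExp_neg_one]

theorem commExp_of_anticomm {h k : H} (e : mat h * mat k = -(mat k * mat h)) :
    commExp h k = 1 := by
  have h2 : mat (h * k) * mat (h * k) = -((mat h * mat h) * (mat k * mat k)) := by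
    rw [mat_mul]
    have e' : mat k * mat h = -(mat h * mat k) := by rw [e, neg_neg]
    calc mat h * mat k * (mat h * mat k) = mat h * (mat k * mat h) * mat k := by
          simp only [Matrix.mul_assoc]
      _ = _ := by rw [e']; simp only [Matrix.mul_assoc, Matrix.mul_neg, Matrix.neg_mul]
  unfold commExp
  rw [← cls_mul, qFun_cls, qFun_cls, qFun_cls, h2]
  rcases H_sq h with a | a <;> rcases H_sq k with b | b <;>
    simp [a, b, signExp_one, signExp_neg_one]

theorem commExp_mul (h h' k : H) : commExp (h * h') k = commExp h k + commExp h' k := by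
  have key : mat (h * h') * mat k = mat h * (mat h' * mat k) := by
    rw [mat_mul, Matrix.mul_assoc]
  have key2 : mat h * (mat k * mat h') = (mat h * mat k) * mat h' := by rw [Matrix.mul_assoc]
  have key3 : (mat k * mat h) * mat h' = mat k * mat (h * h') := by
    rw [mat_mul, Matrix.mul_assoc]
  rcases H_comm h k with a | a <;> rcases H_comm h' k with b | b
  · rw [commExp_of_comm a, commExp_of_comm b, commExp_of_comm, add_zero]
    rw [key, b, key2, a, key3]
  · rw [commExp_of_comm a, commExp_of_anticomm b, commExp_of_anticomm, zero_add]
    rw [key, b, Matrix.mul_neg, key2, a, key3]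
  · rw [commExp_of_anticomm a, commExp_of_comm b, commExp_of_anticomm, add_zero]
    rw [key, b, key2, a, Matrix.neg_mul, key3]
  · rw [commExp_of_anticomm a, commExp_of_anticomm b, commExp_of_comm]
    · decide
    · rw [key, b, Matrix.mul_neg, key2, a, Matrix.neg_mul, key3, neg_neg]

theorem qFun_zero : qFun 0 = 0 := by
  rw [← cls_one, qFun_cls, mat_one, Matrix.mul_one, signExp_one]

theorem zmod_two_cases : ∀ a : ZMod 2, a = 0 ∨ a = 1 := by decide

/-- The quadratic form `Q` on `A` with `Q({±h}) = 0` if `h² = 1` and `Q({±h}) = 1` if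
`h² = -1`. -/
def Q : QuadraticForm (ZMod 2) A :=
  QuadraticMap.ofPolar qFun
    (by
      intro a x
      rcases zmod_two_cases a with rfl | rfl
      · simp [qFun_zero]
      · simp)
    (by
      intro x x' y
      obtain ⟨h, rfl⟩ := cls_surjective x
      obtain ⟨h', rfl⟩ := cls_surjective x'
      obtain ⟨k, rfl⟩ := cls_surjective y
      exact commExp_mul h h' k)
    (by
      intro a x y
      rcases zmod_two_cases a with rfl | rfl
      · simp [QuadraticMap.polar, qFun_zero]
      · simp)

theorem Q_cls (h : H) : Q (cls h) = signExp (mat h * mat h) := qFun_cls h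

/-! ### The action of `N` on `A` -/

/-- Conjugation of `h ∈ H` by `n ∈ N`. -/
def conj (n : N) : H ≃* H := Subgroup.normalizerMonoidHom H n

theorem mat_conj (n : N) (h : H) :
    mat (conj n h) = ((n : SO8) : Matrix Idx Idx ℝ) * mat h * (((n : SO8)⁻¹ : SO8) :
      Matrix Idx Idx ℝ) := rfl

theorem map_conj_signs (n : N) : signs.map (conj n).toMonoidHom = signs := by
  have key : ∀ n : N, ∀ h ∈ signs, conj n h ∈ signs := by
    intro n h hh
    have hn : ((n : SO8) : Matrix Idx Idx ℝ) * (((n : SO8)⁻¹ : SO8) : Matrix Idx Idx ℝ) = 1 :=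
      congrArg Subtype.val (mul_inv_cancel (n : SO8))
    rw [mem_signs, mat_conj]
    rcases hh with e | e <;> simp only [e, Matrix.mul_one, Matrix.mul_neg, Matrix.neg_mul, hn]
    · exact Or.inl trivial
    · exact Or.inr trivial
  apply le_antisymm
  · rintro _ ⟨h, hh, rfl⟩
    exact key n h hh
  · intro h hh
    refine ⟨conj n⁻¹ h, key n⁻¹ h hh, ?_⟩
    change (conj n * conj n⁻¹ : MulAut H) h = h
    have : (conj n * conj n⁻¹ : MulAut H) = 1 := by
      unfold conj
      rw [← map_mul, mul_inv_cancel, map_one]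
    rw [this]; rfl

/-- The automorphism `{±h} ↦ {±n h n⁻¹}` of `A`. -/
def actLinear (n : N) : A ≃ₗ[ZMod 2] A :=
  let e : A ≃+ A := MulEquiv.toAdditive
    (QuotientGroup.congr signs signs (conj n) (map_conj_signs n))
  { e with map_smul' := fun c x => ZMod.map_smul e c x }

theorem actLinear_cls (n : N) (h : H) : actLinear n (cls h) = cls (conj n h) := rfl

/-- The natural action of `N` on `A = H / {±1}` by conjugation, as a homomorphism to `O(Q)`. -/
def act : N →* orthogonalGroup Q where
  toFun n := ⟨actLinear n, by
    intro x
    obtain ⟨h, rfl⟩ := cls_surjective x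
    have hn : (((n : SO8)⁻¹ : SO8) : Matrix Idx Idx ℝ) * ((n : SO8) : Matrix Idx Idx ℝ) = 1 :=
      congrArg Subtype.val (inv_mul_cancel (n : SO8))
    have hn' : ((n : SO8) : Matrix Idx Idx ℝ) * (((n : SO8)⁻¹ : SO8) : Matrix Idx Idx ℝ) = 1 :=
      congrArg Subtype.val (mul_inv_cancel (n : SO8))
    rw [actLinear_cls, Q_cls, Q_cls, ← mat_mul, ← map_mul, mat_conj, mat_mul]
    rcases H_sq h with e | e <;> simp only [e, Matrix.mul_one, Matrix.mul_neg, Matrix.neg_mul, hn']⟩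
  map_one' := by
    apply Subtype.ext
    ext x
    obtain ⟨h, rfl⟩ := cls_surjective x
    change actLinear 1 (cls h) = cls h
    rw [actLinear_cls]
    unfold conj
    rw [map_one]; rfl
  map_mul' m n := by
    apply Subtype.ext
    ext x
    obtain ⟨h, rfl⟩ := cls_surjective x
    change actLinear (m * n) (cls h) = actLinear m (actLinear n (cls h))
    rw [actLinear_cls, actLinear_cls, actLinear_cls]
    unfold conj
    rw [map_mul]; rfl

/-! ### Weight spaces of singular subspaces and the involutions `𝔯₂` -/

/-- The preimage in `H` of a subspace of `A`. -/
def preimage (S : Submodule (ZMod 2) A) : Subgroup H where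
  carrier := {h | cls h ∈ S}
  one_mem' := S.zero_mem
  mul_mem' hh hk := S.add_mem hh hk
  inv_mem' hh := S.neg_mem hh

/-- A subspace is singular if `Q` vanishes identically on it. -/
def IsSingular (S : Submodule (ZMod 2) A) : Prop := ∀ x ∈ S, Q x = 0

/-- The subspace of the vectors in `ℝ⁸` on which a group `E ≤ H` acts through the
character `χ`. -/
def weightSpace (E : Subgroup H) (χ : E →* ℝˣ) : Submodule ℝ (Idx → ℝ) :=
  ⨅ h : E, Module.End.eigenspace (Matrix.toLin' (mat h)) (χ h : ℝ)

/-- The collection `K_{2^{3-i}}` of the (nonzero) weight spaces in `ℝ⁸` of the preimages in `H` of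
the `i`-dimensional singular subspaces of `A`. -/
def singularWeightSpaces (i : ℕ) : Set (Submodule ℝ (Idx → ℝ)) :=
  {U | U ≠ ⊥ ∧ ∃ S : Submodule (ZMod 2) A, IsSingular S ∧ Module.finrank (ZMod 2) S = i ∧
    ∃ χ : preimage S →* ℝˣ, U = weightSpace (preimage S) χ}

/-- The set `𝔯₂` of the involutions in `SO₈` whose `(-1)`-eigenspace is a (two-dimensional) weight
space coming from a two-dimensional singular subspace of `A`. -/
def R₂ : Set SO8 :=
  {r | orderOf r = 2 ∧
    Module.End.eigenspace (Matrix.toLin' (r : Matrix Idx Idx ℝ)) (-1) ∈ singularWeightSpaces 2}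

end ExoticRotationGroup

end

namespace ExoticRotationGroup

/-! ### The hyperbolic quadratic space `𝔽₂³ × 𝔽₂³` -/

/-! Up to sign, `H` consists of the 64 Heisenberg matrices `heis v`, tensor products of the matrices
`XˣZᶻ`. The square of `heis v` is given by `quad v` and commutators by `pol`, so `A` is identified
with the hyperbolic space `C = 𝔽₂³ × 𝔽₂³` (`coord`, `Q_coord`, `polar_coord`).

Structure of `O⁺(Q)`. Reflections generate `O(Q)` (`closure_refl_eq_top`) and each one changes the
parity of the rank of `u - 1` (`dicksonInvariant_reflection_mul`), so the Dickson invariant is a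
homomorphism whose kernel consists of the products of evenly many reflections. On the other side
`SL₄(2)` acts faithfully on alternating 4×4 matrices by `M ↦ g M gᵀ` and preserves the Pfaffian,
which is `quad` in coordinates. A product of two reflections is such a congruence
(`alt_reflC_reflC`). Conversely transvections act as Siegel transformations
(`exists_siegelC_eq_transvection`), and these are products of four reflections
(`dicksonInvariant_of_siegelC`). Hence `O⁺(Q)` is the image of `SL₄(2)`.

The involutions. A singular plane with basis `v, w` and two signs give commuting symmetric
involutions `a, b`, and `(1 + a + b - ab) / 2` is `-1` exactly on their common `(-1)`-eigenspace, of
dimension two by a trace computation. These are all the elements of `R₂`: 105 planes with four sign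
choices each. Such an involution acts on `A` as the Siegel transformation of its plane
(`act_lineRot`), so the group generated by `R₂` maps onto `O⁺(Q)`. Products of two involutions on
the same plane yield all of `H` (`H_le_closure`), and `H` contains the kernel of the action
(`mem_H_of_act_eq_one`, a Schur argument). Therefore `R₂` generates `L`.

The Heisenberg matrices span all 8×8 matrices, over `ℂ` as well, which gives absolute
irreducibility. For primitivity, at most 8 blocks permuted by 64 classes force a nonzero class to
fix a block, and then all blocks. The classes fixing all blocks form a subgroup stable under Siegel
transformations, hence everything, which contradicts irreducibility. -/

/-- The space `𝔽₂³`. -/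
abbrev F : Type := ZMod 2 × ZMod 2 × ZMod 2

/-- The coordinate space `𝔽₂³ × 𝔽₂³` of `A`. -/
abbrev C : Type := F × F

/-- The standard bilinear form on `𝔽₂³`. -/
def dot (x y : F) : ZMod 2 := x.1 * y.1 + x.2.1 * y.2.1 + x.2.2 * y.2.2

/-- The hyperbolic quadratic form on `𝔽₂³ × 𝔽₂³`. -/
def quad (v : C) : ZMod 2 := dot v.1 v.2

/-- The polar form of `quad`. -/
def pol (v w : C) : ZMod 2 := dot v.1 w.2 + dot v.2 w.1

theorem quad_add (v w : C) : quad (v + w) = quad v + quad w + pol v w := by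
  simp only [quad, pol, dot, Prod.fst_add, Prod.snd_add]; ring

theorem pol_add_left (u v w : C) : pol (u + v) w = pol u w + pol v w := by
  simp only [pol, dot, Prod.fst_add, Prod.snd_add]; ring

theorem pol_add_right (u v w : C) : pol u (v + w) = pol u v + pol u w := by
  simp only [pol, dot, Prod.fst_add, Prod.snd_add]; ring

theorem pol_comm (v w : C) : pol v w = pol w v := by
  simp only [pol, dot]; ring

theorem C_add_self (v : C) : v + v = 0 := CharTwo.add_self_eq_zero v

theorem quad_zero : quad 0 = 0 := rfl

/-- `v` and `w` span a totally singular plane. -/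
def IsLine (v w : C) : Prop :=
  v ≠ 0 ∧ w ≠ 0 ∧ v ≠ w ∧ quad v = 0 ∧ quad w = 0 ∧ pol v w = 0

/-- The map `u ↦ u + (u, v) v`, a reflection if `quad v = 1`. -/
def reflC (v u : C) : C := u + pol u v • v

/-- The Siegel transformation `u ↦ u + (u, v) w + (u, w) v`. -/
def siegelC (v w u : C) : C := u + pol u v • w + pol u w • v

/-! ### Binary codes of vectors, for computations -/

/-- The digit of an element of `𝔽₂`. -/
def digit (a : ZMod 2) : Bool := decide (a = 1)

theorem digit_add : ∀ a b, digit (a + b) = bne (digit a) (digit b) := by decide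

/-- The number with the coordinates of `v` as its binary digits. -/
def code (v : C) : ℕ :=
  Nat.bit (digit v.1.1) (Nat.bit (digit v.1.2.1) (Nat.bit (digit v.1.2.2)
    (Nat.bit (digit v.2.1) (Nat.bit (digit v.2.2.1) (Nat.bit (digit v.2.2.2) 0)))))

/-- The vector with a given code. -/
def decode (n : ℕ) : C :=
  let d (i : ℕ) : ZMod 2 := bif n.testBit i then 1 else 0
  ((d 0, d 1, d 2), (d 3, d 4, d 5))

theorem decode_code : ∀ v, decode (code v) = v := by decide +kernel

theorem code_decode : ∀ n < 64, code (decode n) = n := by decide +kernel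

theorem code_lt : ∀ v, code v < 64 := by decide +kernel

theorem code_injective : Function.Injective code :=
  Function.LeftInverse.injective decode_code

theorem code_zero : code 0 = 0 := rfl

theorem code_eq_zero {v : C} : code v = 0 ↔ v = 0 := code_injective.eq_iff' code_zero

/-- Addition in characteristic 2 is addition without carry. This turns every finite check on vectors
into bit arithmetic on numbers below 64. -/
theorem code_add (v w : C) : code (v + w) = code v ^^^ code w := by
  simp only [code, Nat.xor_bit, Prod.fst_add, Prod.snd_add, digit_add, Nat.xor_self]

/-- The value of `quad` on the vector with code `n`. -/
def quadN (n : ℕ) : ℕ := ((n &&& (n >>> 3)) ^^^ ((n &&& (n >>> 3)) >>> 1) ^^^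
  ((n &&& (n >>> 3)) >>> 2)) % 2

/-- The three bits of `n &&& (n >>> 3)` are the products of paired coordinates; xoring its shifts
puts the parity of their sum in the lowest bit. -/
theorem cast_quadN : ∀ v, (quadN (code v) : ZMod 2) = quad v := by decide +kernel

/-- The value of `pol` on the vectors with codes `m` and `n`. -/
def polN (m n : ℕ) : ℕ := (quadN (m ^^^ n) + quadN m + quadN n) % 2

theorem quad_eq_zero_iff (v : C) : quad v = 0 ↔ quadN (code v) = 0 := by
  rw [← cast_quadN, ZMod.natCast_eq_zero_iff, Nat.dvd_iff_mod_eq_zero, quadN, Nat.mod_mod]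

theorem quad_eq_one_iff (v : C) : quad v = 1 ↔ quadN (code v) = 1 := by
  have h1 : quadN (code v) = 0 ∨ quadN (code v) = 1 := by unfold quadN; omega
  have h2 := quad_eq_zero_iff v
  rcases zmod_two_cases (quad v) with h | h <;> simp_all

theorem cast_polN (v w : C) : (polN (code v) (code w) : ZMod 2) = pol v w := by
  rw [polN, ZMod.natCast_mod, Nat.cast_add, Nat.cast_add, ← code_add, cast_quadN, cast_quadN,
    cast_quadN, quad_add]
  linear_combination (quad v + quad w) * CharTwo.two_eq_zero (R := ZMod 2)

theorem pol_eq_zero_iff (v w : C) : pol v w = 0 ↔ polN (code v) (code w) = 0 := by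
  rw [← cast_polN, ZMod.natCast_eq_zero_iff, Nat.dvd_iff_mod_eq_zero, polN, Nat.mod_mod]

theorem pol_eq_one_iff (v w : C) : pol v w = 1 ↔ polN (code v) (code w) = 1 := by
  have h1 : polN (code v) (code w) = 0 ∨ polN (code v) (code w) = 1 := by unfold polN; omega
  have h2 := pol_eq_zero_iff v w
  rcases zmod_two_cases (pol v w) with h | h <;> simp_all

theorem code_pol_smul (v w u : C) : code (pol v w • u) = polN (code v) (code w) * code u := by
  rcases zmod_two_cases (pol v w) with h | h
  · rw [h, (pol_eq_zero_iff _ _).1 h, zero_smul, code_zero, zero_mul]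
  · rw [h, (pol_eq_one_iff _ _).1 h, one_smul, one_mul]

/-- `IsLine` in terms of codes. -/
def lineN (m n : ℕ) : Bool :=
  m != 0 && n != 0 && m != n && quadN m == 0 && quadN n == 0 && polN m n == 0

theorem isLine_iff (v w : C) : IsLine v w ↔ lineN (code v) (code w) = true := by
  simp only [IsLine, lineN, Bool.and_eq_true, bne_iff_ne, ne_eq, beq_iff_eq, quad_eq_zero_iff,
    pol_eq_zero_iff, code_eq_zero, code_injective.eq_iff]
  tauto

instance (v w : C) : Decidable (IsLine v w) := decidable_of_iff' _ (isLine_iff v w)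

/-- A universally quantified statement about vectors can be checked on codes. -/
theorem forall_of_code {p : C → Prop} {q : ℕ → Bool} (h : (List.range 64).all q = true)
    (hpq : ∀ v, q (code v) = true → p v) (v : C) : p v :=
  hpq v (List.all_eq_true.1 h _ (List.mem_range.2 (code_lt v)))

/-- A witness can be searched for among codes. -/
theorem exists_of_code {p : C → Prop} {q : ℕ → Bool} (h : (List.range 64).any q = true)
    (hpq : ∀ v, q (code v) = true → p v) : ∃ v, p v := by
  obtain ⟨n, hn, h⟩ := List.any_eq_true.1 h
  exact ⟨decode n, hpq _ (by rwa [code_decode n (List.mem_range.1 hn)])⟩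

/-- One basis for each totally singular plane. -/
def lineReps : Set (C × C) :=
  {p | code p.1 < code p.2 ∧ code p.2 < code (p.1 + p.2) ∧ IsLine p.1 p.2}

/-- The count agrees with 35 · 9 / 3: there are 35 nonzero singular vectors, each lies in 9 singular
planes, and each plane contains three of them. The two inequalities select one of the six ordered
bases of a plane. -/
theorem card_filter_lineN : ((Finset.range 64 ×ˢ Finset.range 64).filter fun p : ℕ × ℕ =>
    lineN p.1 p.2 = true ∧ p.1 < p.2 ∧ p.2 < p.1 ^^^ p.2).card = 105 := by
  decide +kernel

theorem ncard_lineReps : lineReps.ncard = 105 := by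
  have hinj : Function.Injective fun p : C × C => (code p.1, code p.2) := fun p q h =>
    Prod.ext (code_injective (congrArg Prod.fst h)) (code_injective (congrArg Prod.snd h))
  obtain ⟨T, hT, hmem⟩ : ∃ T : Finset (ℕ × ℕ), T.card = 105 ∧ ∀ m n, (m, n) ∈ T ↔
      (m < 64 ∧ n < 64) ∧ lineN m n = true ∧ m < n ∧ n < m ^^^ n :=
    ⟨_, card_filter_lineN, fun m n => by
      rw [Finset.mem_filter, Finset.mem_product, Finset.mem_range, Finset.mem_range]⟩
  rw [← hT, ← Set.ncard_coe_finset, ← Set.ncard_image_of_injective _ hinj]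
  congr 1
  ext ⟨m, n⟩
  rw [Finset.mem_coe, hmem]
  constructor
  · rintro ⟨⟨v, w⟩, ⟨h1, h2, h⟩, heq⟩
    obtain ⟨rfl, rfl⟩ := Prod.mk.inj heq
    exact ⟨⟨code_lt v, code_lt w⟩, (isLine_iff v w).1 h, h1, by rwa [← code_add]⟩
  · rintro ⟨⟨hm, hn⟩, h, h1, h2⟩
    refine ⟨(decode m, decode n), ⟨?_, ?_, ?_⟩, Prod.ext (code_decode m hm) (code_decode n hn)⟩ <;>
      simpa [isLine_iff, code_add, code_decode m hm, code_decode n hn]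

/-! ### Incidence facts checked by exhaustive search -/

/-- The orthogonal complement of a singular plane, modulo the plane, is a hyperbolic plane and so
has a nonsingular vector. Such a `k` serves twice: to write Siegel transformations as products of
reflections, and to provide a complex structure commuting with a pair of involutions. -/
theorem exists_nonsingular_orthogonal (v w : C) :
    IsLine v w → ∃ k : C, quad k = 1 ∧ pol k v = 0 ∧ pol k w = 0 := by
  revert v w
  refine forall_of_code (q := fun m => (List.range 64).all fun n => !lineN m n ||
    (List.range 64).any fun k => quadN k == 1 && polN k m == 0 && polN k n == 0)
    (by decide +kernel) fun v h => ?_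
  refine forall_of_code h fun w h hl => ?_
  rw [isLine_iff] at hl
  rw [hl, Bool.not_true, Bool.false_or] at h
  refine exists_of_code h fun k h => ?_
  simpa [quad_eq_one_iff, pol_eq_zero_iff, and_assoc] using h

/-- A basis of nonsingular vectors, with each one orthogonal to all the others but its
neighbours. -/
def chain : Fin 6 → C :=
  ![((1, 0, 0), (1, 0, 0)), ((0, 0, 1), (1, 0, 1)), ((0, 1, 0), (0, 1, 1)),
    ((0, 0, 1), (0, 0, 1)), ((1, 0, 0), (1, 0, 1)), ((0, 0, 1), (0, 1, 1))]

/-- The codes of the vectors of `chain`. -/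
def chainN : List ℕ := [9, 44, 50, 36, 41, 52]

theorem code_chain (k : Fin 6) : code (chain k) = chainN[(k : ℕ)]! := by
  revert k; decide +kernel

/-- Whether the vector with code `n` is orthogonal to the first `k` vectors of `chain`. -/
def orthChainN (k n : ℕ) : Bool := (List.range k).all fun i => polN (chainN[i]!) n == 0

theorem orthChainN_iff (k : Fin 6) (v : C) :
    orthChainN k (code v) = true ↔ ∀ i < k, pol (chain i) v = 0 := by
  simp only [orthChainN, List.all_eq_true, List.mem_range, beq_iff_eq, pol_eq_zero_iff, code_chain]
  exact ⟨fun h i hi => h i hi, fun h i hi => h ⟨i, hi.trans k.2⟩ hi⟩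

/-- The inductive step of a Witt-type argument: at most two reflections, both fixing the earlier
vectors of the chain, move `y` to `chain k`. For nonsingular `y` and `c`, `quad (y + c) = pol y c`,
so the reflection in `y + c` is available when `pol y c = 1` and exchanges the two; otherwise `y` is
first moved by a preparatory reflection. The value `v = 0` stands for no reflection. The condition
`y ≠ chain i` is not automatic: `chain 0` has the same products as `chain 2` with the first two
vectors. -/
theorem exists_reflections_to_chain (k : Fin 6) (y : C) : quad y = 1 →
    (∀ i < k, y ≠ chain i ∧ pol y (chain i) = pol (chain k) (chain i)) →
    ∃ v, (v = 0 ∨ quad v = 1) ∧ (∀ i < k, pol (chain i) v = 0) ∧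
      (reflC v y = chain k ∨ (quad (reflC v y + chain k) = 1 ∧
        (∀ i < k, pol (chain i) (reflC v y + chain k) = 0) ∧ pol (reflC v y) (chain k) = 1)) := by
  intro h1 h2
  have key : ∀ k < 6, ((List.range 64).all fun y => !(quadN y == 1) ||
      !((List.range k).all fun i => y != chainN[i]! &&
        polN y (chainN[i]!) == polN (chainN[k]!) (chainN[i]!)) ||
      ((List.range 64).any fun v => (v == 0 || quadN v == 1) && orthChainN k v &&
        ((y ^^^ (polN y v * v)) == chainN[k]! ||
          (quadN ((y ^^^ (polN y v * v)) ^^^ chainN[k]!) == 1 &&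
          orthChainN k ((y ^^^ (polN y v * v)) ^^^ chainN[k]!) &&
          polN (y ^^^ (polN y v * v)) (chainN[k]!) == 1)))) = true := by decide +kernel
  have h := List.all_eq_true.1 (key k k.2) _ (List.mem_range.2 (code_lt y))
  have h3 : ((List.range k).all fun i => code y != chainN[i]! &&
      polN (code y) (chainN[i]!) == polN (chainN[(k : ℕ)]!) (chainN[i]!)) = true := by
    rw [List.all_eq_true]
    intro i hi
    rw [List.mem_range] at hi
    obtain ⟨a, b⟩ := h2 ⟨i, hi.trans k.2⟩ hi
    rw [← code_chain k, show chainN[i]! = code (chain ⟨i, hi.trans k.2⟩) from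
      (code_chain ⟨i, hi.trans k.2⟩).symm, Bool.and_eq_true, bne_iff_ne, code_injective.ne_iff,
      beq_iff_eq]
    refine ⟨a, ?_⟩
    rcases zmod_two_cases (pol y (chain ⟨i, hi.trans k.2⟩)) with c | c
    · rw [(pol_eq_zero_iff _ _).1 c, (pol_eq_zero_iff _ _).1 (b ▸ c)]
    · rw [(pol_eq_one_iff _ _).1 c, (pol_eq_one_iff _ _).1 (b ▸ c)]
  rw [h3, (quad_eq_one_iff y).1 h1] at h
  simp only [beq_self_eq_true, Bool.not_true, Bool.false_or] at h
  refine exists_of_code h fun v h => ?_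
  rw [← code_pol_smul, ← code_add, ← code_chain, ← code_add] at h
  simp only [Bool.and_eq_true, Bool.or_eq_true, beq_iff_eq, orthChainN_iff, code_eq_zero,
    ← quad_eq_one_iff, ← pol_eq_one_iff, code_injective.eq_iff] at h
  obtain ⟨⟨a, b⟩, c⟩ := h
  exact ⟨a, b, c.imp id fun c => ⟨c.1.1, c.1.2, c.2⟩⟩

/-- In the nondegenerate quotient of `y`'s orthogonal complement by `y`, the image of `x` is nonzero
and singular vectors span, so some singular vector is not orthogonal to it. The Siegel
transformation of the resulting plane sends `x` to `x + y`. -/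
theorem exists_line_of_orthogonal (x y : C) : x ≠ 0 → x ≠ y → y ≠ 0 → quad y = 0 → pol x y = 0 →
    ∃ a, IsLine a y ∧ pol x a = 1 := by
  revert x y
  refine forall_of_code (q := fun m => (List.range 64).all fun n => m == 0 || m == n ||
    n == 0 || quadN n == 1 || polN m n == 1 || (List.range 64).any fun a => lineN a n &&
      polN m a == 1) (by decide +kernel) fun x h => ?_
  refine forall_of_code h fun y h h1 h2 h3 h4 h5 => ?_
  simp only [Bool.or_eq_true, beq_iff_eq, code_eq_zero, code_injective.eq_iff, h1, h2, h3,
    ← quad_eq_one_iff, ← pol_eq_one_iff, h4, h5, zero_ne_one, false_or] at h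
  refine exists_of_code h fun k h => ?_
  simpa [isLine_iff, pol_eq_one_iff] using h

/-- The common orthogonal complement has dimension at least 4 and contains more than two nonzero
singular vectors. Used to connect arbitrary vectors through a singular one; with `x = y` it also
completes a singular vector to a singular plane. -/
theorem exists_orthogonal_singular (x y : C) :
    ∃ s, s ≠ 0 ∧ quad s = 0 ∧ x ≠ s ∧ s ≠ y ∧ pol x s = 0 ∧ pol s y = 0 := by
  revert x y
  refine forall_of_code (q := fun m => (List.range 64).all fun n =>
    (List.range 64).any fun s => s != 0 && quadN s == 0 && m != s && s != n && polN m s == 0 &&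
      polN s n == 0) (by decide +kernel) fun x h => ?_
  refine forall_of_code h fun y h => exists_of_code h fun s h => ?_
  simpa [pol_eq_zero_iff, quad_eq_zero_iff, code_injective.eq_iff, and_assoc, code_eq_zero] using h

/-! ### Alternating matrices -/

/-- The alternating matrix with given coordinates; its Pfaffian is `quad v`. -/
def alt (v : C) : Matrix (Fin 4) (Fin 4) (ZMod 2) :=
  !![0, v.1.1, v.1.2.1, v.1.2.2; v.1.1, 0, v.2.2.2, v.2.2.1; v.1.2.1, v.2.2.2, 0, v.2.1;
    v.1.2.2, v.2.2.1, v.2.1, 0]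

/-- The coordinates of an alternating matrix. -/
def altCoord (M : Matrix (Fin 4) (Fin 4) (ZMod 2)) : C :=
  ((M 0 1, M 0 2, M 0 3), (M 2 3, M 1 3, M 1 2))

theorem altCoord_alt (v : C) : altCoord (alt v) = v := rfl

theorem alt_injective : Function.Injective alt := Function.LeftInverse.injective altCoord_alt

theorem alt_add (v w : C) : alt (v + w) = alt v + alt w := by
  ext i j; fin_cases i <;> fin_cases j <;> simp [alt]

theorem alt_altCoord (T : Matrix (Fin 4) (Fin 4) (ZMod 2)) :
    alt (altCoord (T + Tᵀ)) = T + Tᵀ := by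
  ext i j; fin_cases i <;> fin_cases j <;>
    simp [alt, altCoord, CharTwo.add_self_eq_zero] <;> rw [add_comm]

theorem exists_alt_eq (v : C) : ∃ T, alt v = T + Tᵀ :=
  ⟨!![0, v.1.1, v.1.2.1, v.1.2.2; 0, 0, v.2.2.2, v.2.2.1; 0, 0, 0, v.2.1; 0, 0, 0, 0], by
    ext i j
    rw [Matrix.add_apply, Matrix.transpose_apply]
    fin_cases i <;> fin_cases j <;> simp [alt]⟩

theorem alt_transpose (v : C) : (alt v)ᵀ = alt v := by
  ext i j; fin_cases i <;> fin_cases j <;> simp [alt]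

/-- The determinant is the square of the Pfaffian, and squaring is trivial on `𝔽₂`. -/
theorem det_alt (v : C) : (alt v).det = quad v := by
  obtain ⟨⟨a, b, c⟩, d, e, f⟩ := v
  simp only [alt, quad, dot, Matrix.det_succ_row_zero, Fin.sum_univ_succ]
  simp [Fin.succAbove]
  revert a b c d e f
  decide +kernel

/-- The coordinate vector of the alternating matrix with entries `1` at `(i, j)` and `(j, i)`. -/
def wedge (i j : Fin 4) : C := altCoord (Matrix.single i j 1 + Matrix.single j i 1)

theorem quad_swap (v : C) : quad v.swap = quad v := by
  simp only [quad, dot, Prod.fst_swap, Prod.snd_swap]; ring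

/-- Swapping the two halves exchanges complementary index pairs, which in characteristic 2 produces
the Pfaffian adjoint. -/
theorem alt_mul_alt_swap_self (v : C) :
    alt v * alt v.swap = quad v • (1 : Matrix (Fin 4) (Fin 4) (ZMod 2)) := by
  have h : ∀ a : ZMod 2, a + a = 0 := CharTwo.add_self_eq_zero
  ext i j
  fin_cases i <;> fin_cases j <;>
    simp [alt, quad, dot, Matrix.mul_apply, Fin.sum_univ_four] <;> grind

/-- The Clifford relation, obtained by polarizing `alt_mul_alt_swap_self`. -/
theorem alt_mul_alt_swap (u v : C) :
    alt v * alt u.swap + alt u * alt v.swap = pol u v • (1 : Matrix (Fin 4) (Fin 4) (ZMod 2)) := by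
  have h := alt_mul_alt_swap_self (u + v)
  rw [Prod.swap_add, alt_add, alt_add, Matrix.add_mul, Matrix.mul_add, Matrix.mul_add,
    alt_mul_alt_swap_self, alt_mul_alt_swap_self, quad_add, add_smul, add_smul] at h
  rw [← sub_eq_zero] at h ⊢
  rw [← h]
  abel

theorem alt_swap_mul_alt (v : C) :
    alt v.swap * alt v = quad v • (1 : Matrix (Fin 4) (Fin 4) (ZMod 2)) := by
  rw [← quad_swap, ← alt_mul_alt_swap_self, Prod.swap_swap]

theorem alt_smul (a : ZMod 2) (v : C) : alt (a • v) = a • alt v := by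
  ext i j; fin_cases i <;> fin_cases j <;> simp [alt]

/-- Multiplying the Clifford relation on the right by `alt v` expresses a reflection as a sandwich.
The inner factor is the dual of `u`, so a single reflection is not yet a congruence. -/
theorem alt_mul_alt_swap_mul_alt (v u : C) (hv : quad v = 1) :
    alt v * alt u.swap * alt v = alt (reflC v u) := by
  have h := congrArg (· * alt v) (alt_mul_alt_swap u v)
  simp only [Matrix.add_mul, Matrix.mul_assoc (alt u), alt_swap_mul_alt, hv, one_smul,
    Matrix.mul_one, Matrix.smul_mul, Matrix.one_mul] at h
  rw [reflC, alt_add, alt_smul, ← h, add_comm, add_assoc, CharTwo.add_self_eq_zero, add_zero]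

theorem reflC_swap (v u : C) : (reflC v u).swap = reflC v.swap u.swap := by
  have : pol u v = pol u.swap v.swap := by
    simp only [pol, Prod.fst_swap, Prod.snd_swap]; ring
  rw [reflC, reflC, ← this]; rfl

/-- The two dualizations cancel, leaving the congruence by `alt v * alt w.swap`. This places even
products of reflections in the image of `SL₄(2)`. -/
theorem alt_reflC_reflC {v w : C} (hv : quad v = 1) (hw : quad w = 1) (u : C) :
    alt v * alt w.swap * alt u * (alt v * alt w.swap)ᵀ = alt (reflC v (reflC w u)) := by
  rw [Matrix.transpose_mul, alt_transpose, alt_transpose, ← alt_mul_alt_swap_mul_alt v _ hv,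
    reflC_swap, ← alt_mul_alt_swap_mul_alt w.swap _ (by rwa [quad_swap]), Prod.swap_swap]
  simp only [Matrix.mul_assoc]

theorem alt_wedge (i j : Fin 4) : alt (wedge i j) = Matrix.single i j 1 + Matrix.single j i 1 := by
  have := alt_altCoord (Matrix.single i j 1)
  rwa [Matrix.transpose_single] at this

theorem alt_apply_self (u : C) (j : Fin 4) : alt u j j = 0 := by
  fin_cases j <;> rfl

set_option synthInstance.maxSize 1000 in
set_option synthInstance.maxHeartbeats 400000 in
-- The polar form pairs complementary index pairs, so a basic bivector reads off the entry at the
-- other two indices.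
theorem pol_wedge (u : C) : ∀ i j k l : Fin 4, i ≠ j → i ≠ k → i ≠ l → j ≠ k → j ≠ l → k ≠ l →
    pol u (wedge i k) = alt u j l := by
  obtain ⟨⟨a, b, c⟩, d, e, f⟩ := u
  revert a b c d e f
  decide +kernel

theorem single_mul_eq (M : Matrix (Fin 4) (Fin 4) (ZMod 2)) {i j k l : Fin 4} (hij : i ≠ j)
    (hik : i ≠ k) (hil : i ≠ l) (hjk : j ≠ k) (hjl : j ≠ l) (hkl : k ≠ l) (hM : M j j = 0) :
    Matrix.single i j 1 * M = M j i • Matrix.single i i 1 + M j k • Matrix.single i k 1 +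
      M j l • Matrix.single i l 1 := by
  have hq : ∀ q, q = i ∨ q = j ∨ q = k ∨ q = l := by
    clear hM
    revert i j k l
    decide
  ext p q
  by_cases hp : p = i
  · subst hp
    rw [Matrix.single_mul_apply_same]
    rcases hq q with rfl | rfl | rfl | rfl <;>
      simp [hM, hij, hik, hil, hkl, hik.symm, hil.symm,
        hjk.symm, hjl.symm, hkl.symm]
  · rw [Matrix.single_mul_apply_of_ne _ _ _ _ _ hp]
    simp [Ne.symm hp]

set_option synthInstance.maxSize 1000 in
set_option synthInstance.maxHeartbeats 400000 in
-- For alternating `M`, congruence by `1 + E_ij` adds `E_ij M + M E_ji`. With `k, l` the other two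
-- indices this is `M_jk e_i∧e_k + M_jl e_i∧e_l`, the Siegel term of the singular plane spanned by
-- `e_i∧e_k` and `e_i∧e_l`.
theorem exists_siegelC_eq_transvection (i j : Fin 4) (hij : i ≠ j) : ∃ v w, IsLine v w ∧ ∀ u,
    alt (siegelC v w u) =
      Matrix.transvection i j 1 * alt u * (Matrix.transvection i j 1)ᵀ := by
  have key : ∀ i j : Fin 4, i ≠ j → ∃ k l : Fin 4, i ≠ k ∧ i ≠ l ∧ j ≠ k ∧ j ≠ l ∧ k ≠ l := by
    decide
  obtain ⟨k, l, hik, hil, hjk, hjl, hkl⟩ := key i j hij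
  refine ⟨wedge i k, wedge i l, ?_, fun u => ?_⟩
  · clear key
    revert i j k l
    decide +kernel
  · have h1 := single_mul_eq (alt u) hij hik hil hjk hjl hkl (alt_apply_self u j)
    have h2 := congrArg Matrix.transpose h1
    simp only [Matrix.transpose_mul, Matrix.transpose_add, Matrix.transpose_smul, alt_transpose,
      Matrix.transpose_single] at h2
    -- The second-order term carries the diagonal entry `M_jj`, which vanishes.
    have h3 : Matrix.single i j 1 * alt u * Matrix.single j i 1 = 0 := by
      ext p q
      simp [Matrix.single_mul_mul_single, alt_apply_self]
    -- The diagonal term occurs once in `E_ij M` and once in its transpose.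
    have h4 := CharTwo.add_self_eq_zero (alt u j i • Matrix.single i i (1 : ZMod 2))
    rw [Matrix.transvection, Matrix.transpose_add, Matrix.transpose_one, Matrix.transpose_single,
      Matrix.add_mul, Matrix.one_mul, Matrix.mul_add, Matrix.mul_one, Matrix.add_mul, h3, h2, h1,
      siegelC, alt_add, alt_add, alt_smul, alt_smul, alt_wedge, alt_wedge,
      pol_wedge u i j k l hij hik hil hjk hjl hkl, pol_wedge u i j l k hij hil hik hjl hjk hkl.symm,
      smul_add, smul_add]
    generalize alt u j i • Matrix.single i i (1 : ZMod 2) = X at h4 ⊢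
    rw [add_zero, ← sub_eq_zero, ← neg_eq_zero.2 h4]
    abel


/-! ### The Heisenberg matrices -/

section Heisenberg

variable (K : Type*) [Field K]

/-- The sign character of `𝔽₂`. -/
noncomputable def sgn (a : ZMod 2) : K := if a = 0 then 1 else -1

@[simp] theorem sgn_zero : sgn K 0 = 1 := if_pos rfl

@[simp] theorem sgn_one : sgn K 1 = -1 := if_neg (by decide)

theorem sgn_add (a b : ZMod 2) : sgn K (a + b) = sgn K a * sgn K b := by
  rcases zmod_two_cases a with rfl | rfl <;> rcases zmod_two_cases b with rfl | rfl <;>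
    simp [CharTwo.add_self_eq_zero]

theorem sgn_mul_self (a : ZMod 2) : sgn K a * sgn K a = 1 := by
  rw [← sgn_add, CharTwo.add_self_eq_zero, sgn_zero]

/-- The matrix `Xˣ Zᶻ`, where `X` swaps the basis vectors and `Z` changes the sign of the second
one. -/
noncomputable def pauli (x z : ZMod 2) : Matrix (Fin 2) (Fin 2) K :=
  if x = 0 then !![1, 0; 0, sgn K z] else !![0, sgn K z; 1, 0]

theorem pauli_zero_zero : pauli K 0 0 = 1 := by
  simp [pauli, Matrix.one_fin_two]

theorem pauli_mul (x z x' z' : ZMod 2) :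
    pauli K x z * pauli K x' z' = sgn K (z * x') • pauli K (x + x') (z + z') := by
  rcases zmod_two_cases x with rfl | rfl <;> rcases zmod_two_cases x' with rfl | rfl <;>
    simp [pauli, sgn_add, ← mul_assoc, sgn_mul_self, CharTwo.add_self_eq_zero]

theorem pauli_transpose (x z : ZMod 2) : (pauli K x z)ᵀ = sgn K (x * z) • pauli K x z := by
  rcases zmod_two_cases x with rfl | rfl <;> ext i j <;> fin_cases i <;> fin_cases j <;>
    simp [pauli, sgn_mul_self]

theorem trace_pauli (x z : ZMod 2) :
    (pauli K x z).trace = if x = 0 ∧ z = 0 then 2 else 0 := by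
  rcases zmod_two_cases x with rfl | rfl <;> rcases zmod_two_cases z with rfl | rfl <;>
    simp [pauli, Matrix.trace_fin_two, one_add_one_eq_two]

theorem det_pauli_sq (x z : ZMod 2) : (pauli K x z).det ^ 2 = 1 := by
  rcases zmod_two_cases x with rfl | rfl <;> rcases zmod_two_cases z with rfl | rfl <;>
    simp [pauli, Matrix.det_fin_two]

/-- The Heisenberg matrices, acting on the three-fold tensor power of `K²`. -/
noncomputable def heis (v : C) : Matrix Idx Idx K :=
  pauli K v.1.1 v.2.1 ⊗ₖ (pauli K v.1.2.1 v.2.2.1 ⊗ₖ pauli K v.1.2.2 v.2.2.2)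

theorem heis_zero : heis K 0 = 1 := by
  simp [heis, pauli_zero_zero]

theorem heis_mul (v w : C) : heis K v * heis K w = sgn K (dot v.2 w.1) • heis K (v + w) := by
  simp only [heis, ← Matrix.mul_kronecker_mul, pauli_mul, Matrix.smul_kronecker,
    Matrix.kronecker_smul, smul_smul, dot, sgn_add, Prod.fst_add, Prod.snd_add]
  congr 1
  ring

theorem heis_transpose (v : C) : (heis K v)ᵀ = sgn K (quad v) • heis K v := by
  simp only [heis, ← Matrix.kroneckerMap_transpose, pauli_transpose, Matrix.smul_kronecker,
    Matrix.kronecker_smul, smul_smul, quad, dot, sgn_add]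
  congr 1
  ring

theorem trace_heis (v : C) : (heis K v).trace = if v = 0 then 8 else 0 := by
  rw [heis, Matrix.trace_kronecker, Matrix.trace_kronecker, trace_pauli, trace_pauli, trace_pauli]
  obtain ⟨⟨a, b, c⟩, d, e, f⟩ := v
  by_cases h : ((a, b, c), (d, e, f)) = (0 : C)
  · rw [if_pos h]
    simp only [Prod.mk_eq_zero] at h
    simp [h]
    norm_num
  · rw [if_neg h]
    simp only [Prod.mk_eq_zero] at h
    by_cases h1 : a = 0 ∧ d = 0 <;> by_cases h2 : b = 0 ∧ e = 0 <;>
      by_cases h3 : c = 0 ∧ f = 0 <;> simp [h1, h2, h3]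
    tauto

theorem heis_mul_self (v : C) : heis K v * heis K v = sgn K (quad v) • 1 := by
  rw [heis_mul, C_add_self, heis_zero, quad]
  congr 2
  simp only [dot]; ring

theorem heis_mul_comm (v w : C) :
    heis K v * heis K w = sgn K (pol v w) • (heis K w * heis K v) := by
  rw [heis_mul, heis_mul, smul_smul, add_comm w v, ← sgn_add]
  congr 2
  simp only [dot, pol]
  linear_combination -(w.2.1 * v.1.1 + w.2.2.1 * v.1.2.1 + w.2.2.2 * v.1.2.2) *
    CharTwo.two_eq_zero (R := ZMod 2)

/-- Nontrivial Heisenberg matrices have trace zero, so the trace of a relation multiplied by `heis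
w` isolates the coefficient at `w`. -/
theorem linearIndependent_heis [CharZero K] : LinearIndependent K (heis K) := by
  rw [Fintype.linearIndependent_iff]
  intro g hg w
  have h := congrArg (fun M => (M * heis K w).trace) hg
  simp only [Finset.sum_mul, Matrix.smul_mul, heis_mul, Matrix.trace_sum, Matrix.trace_smul,
    Matrix.zero_mul, Matrix.trace_zero, trace_heis] at h
  rw [Finset.sum_eq_single w] at h
  · rw [if_pos (C_add_self w)] at h
    have h2 : sgn K (dot w.2 w.1) ≠ 0 := fun h0 => by
      have := sgn_mul_self K (dot w.2 w.1)
      simp [h0] at this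
    simpa [h2] using h
  · intro v _ hv
    rw [if_neg, smul_zero, smul_zero]
    intro h0
    exact hv (by rw [← add_zero v, ← C_add_self w, ← add_assoc, h0, zero_add])
  · simp

/-- 64 independent matrices fill the 64-dimensional space of 8×8 matrices. -/
theorem span_heis [CharZero K] : Submodule.span K (Set.range (heis K)) = ⊤ := by
  apply (linearIndependent_heis K).span_eq_top_of_card_eq_finrank'
  rw [Module.finrank_matrix]
  simp [ZMod.card]

/-- A subspace that is invariant under the Heisenberg matrices is trivial. -/
theorem eq_bot_or_eq_top_of_heis [CharZero K] (U : Submodule K (Idx → K))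
    (hU : ∀ v, ∀ x ∈ U, heis K v *ᵥ x ∈ U) : U = ⊥ ∨ U = ⊤ := by
  have key : ∀ M : Matrix Idx Idx K, ∀ x ∈ U, M *ᵥ x ∈ U := by
    intro M x hx
    have hM : M ∈ Submodule.span K (Set.range (heis K)) := by rw [span_heis]; trivial
    induction hM using Submodule.span_induction with
    | mem M hM => obtain ⟨v, rfl⟩ := hM; exact hU v x hx
    | zero => rw [Matrix.zero_mulVec]; exact U.zero_mem
    | add M M' _ _ h h' => rw [Matrix.add_mulVec]; exact U.add_mem h h'
    | smul c M _ h => rw [Matrix.smul_mulVec]; exact U.smul_mem c h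
  rw [or_iff_not_imp_left]
  intro h
  obtain ⟨x, hx, hx0⟩ := U.exists_mem_ne_zero_of_ne_bot h
  obtain ⟨i, hi⟩ := Function.ne_iff.1 hx0
  rw [eq_top_iff]
  intro y _
  -- A rank-one matrix sending `x` to the arbitrary vector `y`.
  have := key (Matrix.vecMulVec y (Pi.single i (x i)⁻¹)) x hx
  rw [Matrix.vecMulVec_mulVec] at this
  simpa [inv_mul_cancel₀ hi] using this

/-- A matrix that commutes with the Heisenberg matrices is scalar. -/
theorem exists_eq_smul_one_of_heis [CharZero K] (M : Matrix Idx Idx K)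
    (h : ∀ v, M * heis K v = heis K v * M) : ∃ c : K, M = c • 1 := by
  have key : ∀ N : Matrix Idx Idx K, M * N = N * M := by
    intro N
    have hN : N ∈ Submodule.span K (Set.range (heis K)) := by rw [span_heis]; trivial
    induction hN using Submodule.span_induction with
    | mem M hM => obtain ⟨v, rfl⟩ := hM; exact h v
    | zero => simp
    | add _ _ _ _ h h' => rw [Matrix.mul_add, Matrix.add_mul, h, h']
    | smul c _ _ h => rw [Matrix.mul_smul, Matrix.smul_mul, h]
  obtain ⟨c, hc⟩ := Matrix.mem_range_scalar_of_commute_single (M := M) fun i j _ => (key _).symm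
  exact ⟨c, by rw [← hc, Matrix.scalar_apply, Matrix.smul_one_eq_diagonal]⟩

end Heisenberg

theorem map_heis (v : C) : (heis ℝ v).map (algebraMap ℝ ℂ) = heis ℂ v := by
  have h : ∀ a, algebraMap ℝ ℂ (sgn ℝ a) = sgn ℂ a := by
    intro a; rcases zmod_two_cases a with rfl | rfl <;> simp
  have h' : ∀ x z i j, algebraMap ℝ ℂ (pauli ℝ x z i j) = pauli ℂ x z i j := by
    intro x z i j
    rcases zmod_two_cases x with rfl | rfl <;> fin_cases i <;> fin_cases j <;>
      simp [pauli, ← h]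
  ext ⟨i, j, k⟩ ⟨i', j', k'⟩
  simp only [heis, Matrix.map_apply, Matrix.kronecker_apply, map_mul, h']

/-! ### Coordinates of `A` -/

theorem exists_mem_W_eq_pauli (x z : ZMod 2) :
    ∃ a ∈ W, (a : Matrix (Fin 2) (Fin 2) ℝ) = pauli ℝ x z := by
  have h1 : reflection₁ ∈ W := Subgroup.subset_closure (by simp)
  have h2 : reflection₂ ∈ W := Subgroup.subset_closure (by simp)
  rcases zmod_two_cases x with rfl | rfl <;> rcases zmod_two_cases z with rfl | rfl
  · exact ⟨1, W.one_mem, (pauli_zero_zero ℝ).symm⟩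
  · exact ⟨_, h1, by simp [reflection₁, pauli]⟩
  · exact ⟨_, h2, by simp [reflection₂, pauli]⟩
  · refine ⟨_, W.mul_mem h2 h1, ?_⟩
    change !![0, 1; 1, 0] * !![1, 0; 0, -1] = _
    simp [pauli]

theorem exists_eq_smul_pauli {a : Matrix.orthogonalGroup (Fin 2) ℝ} (ha : a ∈ W) :
    ∃ x z : ZMod 2, ∃ s : ZMod 2, (a : Matrix (Fin 2) (Fin 2) ℝ) = sgn ℝ s • pauli ℝ x z := by
  obtain ⟨s, t, rfl | rfl, rfl | rfl, h | h⟩ := W_form ha <;> rw [h]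
  · exact ⟨0, 0, 0, by simp [pauli]⟩
  · exact ⟨1, 0, 0, by simp [pauli]⟩
  · exact ⟨0, 1, 0, by simp [pauli]⟩
  · exact ⟨1, 1, 1, by simp [pauli]⟩
  · exact ⟨0, 1, 1, by simp [pauli]⟩
  · exact ⟨1, 1, 0, by simp [pauli]⟩
  · exact ⟨0, 0, 1, by simp [pauli]⟩
  · exact ⟨1, 0, 1, by simp [pauli]⟩

theorem heis_mul_transpose (v : C) : heis ℝ v * (heis ℝ v)ᵀ = 1 := by
  rw [heis_transpose, Matrix.mul_smul, heis_mul_self, smul_smul, sgn_mul_self, one_smul]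

theorem exists_mat_eq_heis (v : C) : ∃ h : H, mat h = heis ℝ v := by
  obtain ⟨a, ha, ha'⟩ := exists_mem_W_eq_pauli v.1.1 v.2.1
  obtain ⟨b, hb, hb'⟩ := exists_mem_W_eq_pauli v.1.2.1 v.2.2.1
  obtain ⟨c, hc, hc'⟩ := exists_mem_W_eq_pauli v.1.2.2 v.2.2.2
  refine ⟨⟨⟨heis ℝ v, ?_⟩, a, ha, b, hb, c, hc, ?_⟩, rfl⟩
  · rw [Matrix.mem_specialOrthogonalGroup_iff, Matrix.mem_orthogonalGroup_iff]
    refine ⟨heis_mul_transpose v, ?_⟩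
    rw [heis, Matrix.det_kronecker, Matrix.det_kronecker]
    simp only [Fintype.card_prod, Fintype.card_fin, det_pauli_sq, one_pow, mul_one]
    rw [pow_mul, det_pauli_sq, one_pow]
  · simp only [ha', hb', hc']; rfl

/-- The Heisenberg matrix of `v` as an element of `H`. -/
noncomputable def hElt (v : C) : H := (exists_mat_eq_heis v).choose

@[simp] theorem mat_hElt (v : C) : mat (hElt v) = heis ℝ v := (exists_mat_eq_heis v).choose_spec

theorem exists_mat_eq_neg_one : ∃ h : H, mat h = -1 := by
  refine ⟨hElt ((1, 0, 0), (1, 0, 0)) * hElt ((1, 0, 0), (1, 0, 0)), ?_⟩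
  rw [mat_mul, mat_hElt, heis_mul_self]
  have : quad ((1, 0, 0), (1, 0, 0)) = 1 := by decide
  rw [this, sgn_one, neg_one_smul]

/-- The element `-1` of `H`. -/
noncomputable def negOne : H := exists_mat_eq_neg_one.choose

@[simp] theorem mat_negOne : mat negOne = -1 := exists_mat_eq_neg_one.choose_spec

theorem exists_mat_eq (h : H) : ∃ v, ∃ s, mat h = sgn ℝ s • heis ℝ v := by
  obtain ⟨a, ha, b, hb, c, hc, e⟩ := h.2
  obtain ⟨x, z, s, ea⟩ := exists_eq_smul_pauli ha
  obtain ⟨x', z', s', eb⟩ := exists_eq_smul_pauli hb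
  obtain ⟨x'', z'', s'', ec⟩ := exists_eq_smul_pauli hc
  refine ⟨((x, x', x''), (z, z', z'')), s + (s' + s''), ?_⟩
  rw [mat, e, ea, eb, ec, heis]
  simp only [Matrix.smul_kronecker, Matrix.kronecker_smul, smul_smul, sgn_add]
  congr 1
  ring

theorem exists_mat_eq_or_neg (h : H) : ∃ v, mat h = heis ℝ v ∨ mat h = -heis ℝ v := by
  obtain ⟨v, s, h⟩ := exists_mat_eq h
  refine ⟨v, ?_⟩
  rcases zmod_two_cases s with rfl | rfl
  · left; simpa using h
  · right; simpa using h

/-- The map `v ↦ {± heis v}` from the coordinate space to `A`. -/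
noncomputable def coordHom : C →+ A where
  toFun v := cls (hElt v)
  map_zero' := by rw [cls_eq_zero, mat_hElt, heis_zero]; exact Or.inl rfl
  map_add' v w := by
    rw [← cls_mul, cls_eq, mat_mul, mat_hElt, mat_hElt, mat_hElt, heis_mul]
    rcases zmod_two_cases (dot v.2 w.1) with h | h <;> simp [h]

theorem coordHom_bijective : Function.Bijective coordHom := by
  constructor
  · rw [injective_iff_map_eq_zero]
    intro v hv
    change cls (hElt v) = 0 at hv
    rw [cls_eq_zero, mat_hElt] at hv
    by_contra h0
    have := trace_heis ℝ v
    rcases hv with hv | hv <;> simp [hv, h0] at this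
  · intro x
    obtain ⟨h, rfl⟩ := cls_surjective x
    obtain ⟨v, hv⟩ := exists_mat_eq_or_neg h
    refine ⟨v, cls_eq.2 ?_⟩
    rw [mat_hElt]
    rcases hv with hv | hv <;> simp [hv]

/-- The coordinates of `A`. -/
noncomputable def coord : C ≃ₗ[ZMod 2] A :=
  LinearEquiv.ofBijective (coordHom.toZModLinearMap 2) coordHom_bijective

theorem coord_apply (v : C) : coord v = cls (hElt v) := rfl

theorem cls_eq_coord {h : H} {v : C} :
    cls h = coord v ↔ mat h = heis ℝ v ∨ mat h = -heis ℝ v := by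
  rw [coord_apply, cls_eq, mat_hElt]

theorem cls_eq_coord' {h : H} {v : C} :
    cls h = coord v ↔ ∃ s, mat h = sgn ℝ s • heis ℝ v := by
  rw [cls_eq_coord]
  constructor
  · rintro (h | h)
    · exact ⟨0, by simpa using h⟩
    · exact ⟨1, by simpa using h⟩
  · rintro ⟨s, h⟩
    rcases zmod_two_cases s with rfl | rfl
    · left; simpa using h
    · right; simpa using h

theorem Q_coord (v : C) : Q (coord v) = quad v := by
  rw [coord_apply, Q_cls, mat_hElt, heis_mul_self]
  rcases zmod_two_cases (quad v) with h | h <;> simp [h, signExp_one, signExp_neg_one]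

theorem polar_coord (v w : C) : QuadraticMap.polar Q (coord v) (coord w) = pol v w := by
  rw [QuadraticMap.polar, ← map_add, Q_coord, Q_coord, Q_coord, quad_add]
  ring

instance : Finite A := Finite.of_equiv C coord.toEquiv

instance : Module.Finite (ZMod 2) A := Module.Finite.equiv coord

instance : Finite H := by
  have h : Function.Surjective fun p : C × ZMod 2 =>
      if p.2 = 0 then hElt p.1 else negOne * hElt p.1 := by
    intro h
    obtain ⟨v, hv | hv⟩ := exists_mat_eq_or_neg h
    · exact ⟨(v, 0), mat_injective (by simp [hv])⟩
    · exact ⟨(v, 1), mat_injective (by simp [hv, mat_mul])⟩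
  exact Finite.of_surjective _ h


/-! ### The kernel of the action on `A` -/

theorem coe_mul_coe_inv (g : SO8) :
    (g : Matrix Idx Idx ℝ) * ((g⁻¹ : SO8) : Matrix Idx Idx ℝ) = 1 :=
  congrArg Subtype.val (mul_inv_cancel g)

theorem coe_inv_mul_coe (g : SO8) :
    ((g⁻¹ : SO8) : Matrix Idx Idx ℝ) * (g : Matrix Idx Idx ℝ) = 1 :=
  congrArg Subtype.val (inv_mul_cancel g)

theorem coe_mul_transpose (g : SO8) : (g : Matrix Idx Idx ℝ) * (g : Matrix Idx Idx ℝ)ᵀ = 1 :=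
  coe_mul_coe_inv g

theorem mem_H_of_eq_smul_heis {g : SO8} {s : ZMod 2} {v : C}
    (h : (g : Matrix Idx Idx ℝ) = sgn ℝ s • heis ℝ v) : g ∈ H := by
  rcases zmod_two_cases s with rfl | rfl
  · have : g = (hElt v : SO8) := Subtype.ext (h.trans (by
      change _ = mat (hElt v)
      simp))
    exact this ▸ (hElt v).2
  · have : g = (negOne * hElt v : H) := Subtype.ext (h.trans (by
      change _ = mat (negOne * hElt v)
      simp [mat_mul]))
    exact this ▸ (negOne * hElt v).2

theorem commutes_heis_of_basis {M : Matrix Idx Idx ℝ}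
    (h1 : ∀ x ∈ ({(1, 0, 0), (0, 1, 0), (0, 0, 1)} : Set F),
      Commute M (heis ℝ (x, 0)) ∧ Commute M (heis ℝ (0, x))) (v : C) : Commute M (heis ℝ v) := by
  have hadd : ∀ v w, Commute M (heis ℝ v) → Commute M (heis ℝ w) → Commute M (heis ℝ (v + w)) := by
    intro v w hv hw
    have : heis ℝ (v + w) = sgn ℝ (dot v.2 w.1) • (heis ℝ v * heis ℝ w) := by
      rw [heis_mul, smul_smul, sgn_mul_self, one_smul]
    rw [this]
    exact (hv.mul_right hw).smul_right _
  have hsmul : ∀ (a : ZMod 2) v, Commute M (heis ℝ v) → Commute M (heis ℝ (a • v)) := by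
    intro a v hv
    rcases zmod_two_cases a with rfl | rfl
    · rw [zero_smul, heis_zero]; exact Commute.one_right _
    · rwa [one_smul]
  have hv : v = v.1.1 • ((1, 0, 0), 0) + v.1.2.1 • ((0, 1, 0), 0) + v.1.2.2 • ((0, 0, 1), 0) +
      v.2.1 • (0, (1, 0, 0)) + v.2.2.1 • (0, (0, 1, 0)) + v.2.2.2 • (0, (0, 0, 1)) := by
    ext <;> simp
  simp only [Set.mem_insert_iff, Set.mem_singleton_iff, forall_eq_or_imp, forall_eq] at h1
  rw [hv]
  obtain ⟨⟨a, a'⟩, ⟨b, b'⟩, c, c'⟩ := h1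
  exact hadd _ _ (hadd _ _ (hadd _ _ (hadd _ _ (hadd _ _ (hsmul _ _ a) (hsmul _ _ b))
    (hsmul _ _ c)) (hsmul _ _ a')) (hsmul _ _ b')) (hsmul _ _ c')

/-- Such an `n` commutes with each Heisenberg matrix up to a sign. On the six generators these signs
are matched by some `heis k`; then `heis k * n` commutes with everything, is scalar, and
orthogonality leaves only `n = ±heis k`. -/
theorem mem_H_of_act_eq_one (n : N) (hn : act n = 1) : (n : SO8) ∈ H := by
  have key : ∀ v, ∃ s, ((n : SO8) : Matrix Idx Idx ℝ) * heis ℝ v =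
      sgn ℝ s • (heis ℝ v * ((n : SO8) : Matrix Idx Idx ℝ)) := by
    intro v
    have h : cls (conj n (hElt v)) = coord v :=
      congrArg (fun u : orthogonalGroup Q => (u : A ≃ₗ[ZMod 2] A) (coord v)) hn
    obtain ⟨s, hs⟩ := cls_eq_coord'.1 h
    refine ⟨s, ?_⟩
    rw [mat_conj, mat_hElt] at hs
    rw [← Matrix.smul_mul, ← hs, Matrix.mul_assoc, coe_inv_mul_coe, Matrix.mul_one]
  choose ε hε using key
  set M := ((n : SO8) : Matrix Idx Idx ℝ) with hM
  -- The halves are crossed because `pol` pairs the first half of one vector with the second half of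
  -- the other; thus `pol k` agrees with `ε` on the standard basis.
  let k : C := ((ε (0, (1, 0, 0)), ε (0, (0, 1, 0)), ε (0, (0, 0, 1))),
    (ε ((1, 0, 0), 0), ε ((0, 1, 0), 0), ε ((0, 0, 1), 0)))
  have hcomm : ∀ v, ε v = pol k v → Commute (heis ℝ k * M) (heis ℝ v) := by
    intro v hv
    have h1 := heis_mul_comm ℝ k v
    change heis ℝ k * M * heis ℝ v = heis ℝ v * (heis ℝ k * M)
    rw [Matrix.mul_assoc, hε, Matrix.mul_smul, ← Matrix.mul_assoc, h1, hv, Matrix.smul_mul,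
      smul_smul, sgn_mul_self, one_smul, Matrix.mul_assoc]
  have hall := commutes_heis_of_basis (M := heis ℝ k * M) (by
    simp only [Set.mem_insert_iff, Set.mem_singleton_iff, forall_eq_or_imp, forall_eq]
    refine ⟨⟨hcomm _ ?_, hcomm _ ?_⟩, ⟨hcomm _ ?_, hcomm _ ?_⟩, hcomm _ ?_, hcomm _ ?_⟩ <;>
      simp [pol, dot, k])
  obtain ⟨c, hc⟩ := exists_eq_smul_one_of_heis ℝ _ hall
  have hMc : M = (c * sgn ℝ (quad k)) • heis ℝ k := by
    have := congrArg (fun X => (sgn ℝ (quad k) • heis ℝ k) * X) hc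
    simpa [← Matrix.mul_assoc, heis_mul_self, smul_smul, sgn_mul_self, mul_comm] using this
  have h2 : (c * sgn ℝ (quad k)) * (c * sgn ℝ (quad k)) = 1 := by
    have := coe_mul_transpose (n : SO8)
    rw [← hM, hMc, Matrix.transpose_smul, Matrix.smul_mul, Matrix.mul_smul, heis_mul_transpose,
      smul_smul] at this
    simpa using congrFun (congrFun this 0) 0
  rcases mul_self_eq_one_iff.1 h2 with h | h
  · exact mem_H_of_eq_smul_heis (s := 0) (v := k) (by rw [← hM, hMc, h, sgn_zero])
  · exact mem_H_of_eq_smul_heis (s := 1) (v := k) (by rw [← hM, hMc, h, sgn_one])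


/-! ### Reflections and the Dickson invariant over `𝔽₂` -/

theorem finrank_inf_ker_add_one {K V : Type*} [Field K] [AddCommGroup V] [Module K V]
    [Module.Finite K V] (W : Submodule K V) (φ : V →ₗ[K] K) (h : ∃ x ∈ W, φ x ≠ 0) :
    Module.finrank K (W ⊓ LinearMap.ker φ : Submodule K V) + 1 = Module.finrank K W := by
  obtain ⟨x, hx, hφ⟩ := h
  have h1 : LinearMap.range (φ.domRestrict W) = ⊤ :=
    LinearMap.range_eq_top.2 (LinearMap.surjective fun h0 => hφ (by
      have := congrArg (fun f => f ⟨x, hx⟩) h0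
      simpa using this))
  have h2 := LinearMap.finrank_range_add_finrank_ker (φ.domRestrict W)
  rw [h1, finrank_top, Module.finrank_self, add_comm, LinearMap.domRestrict, LinearMap.ker_comp]
    at h2
  rw [← Submodule.map_comap_subtype, Submodule.finrank_map_subtype_eq, h2]

section Reflection

variable {V : Type*} [AddCommGroup V] [Module (ZMod 2) V] {q : QuadraticForm (ZMod 2) V}

theorem add_self_eq_zero_of_zmod_two (x : V) : x + x = 0 := by
  have : (1 + 1 : ZMod 2) • x = 0 := by rw [show (1 + 1 : ZMod 2) = 0 from rfl, zero_smul]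
  rwa [add_smul, one_smul] at this

theorem polar_self_zmod_two (x : V) : QuadraticMap.polar q x x = 0 := by
  rw [QuadraticMap.polar_self, two_nsmul, CharTwo.add_self_eq_zero]

theorem polar_map (u : orthogonalGroup q) (x y : V) :
    QuadraticMap.polar q ((u : V ≃ₗ[ZMod 2] V) x) ((u : V ≃ₗ[ZMod 2] V) y) =
      QuadraticMap.polar q x y := by
  rw [QuadraticMap.polar, ← map_add, u.2, u.2, u.2, QuadraticMap.polar]

theorem map_add_eq (x y : V) : q (x + y) = q x + q y + QuadraticMap.polar q x y := by
  rw [QuadraticMap.polar]; ring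

variable (q) in
/-- The linear map `x ↦ x + (x, v) v`. -/
def reflectionLinear (v : V) : V →ₗ[ZMod 2] V :=
  LinearMap.id + ((QuadraticMap.polarBilin q).flip v).smulRight v

theorem reflectionLinear_apply (v x : V) :
    reflectionLinear q v x = x + QuadraticMap.polar q x v • v := rfl

theorem reflectionLinear_involutive (v : V) : Function.Involutive (reflectionLinear q v) := by
  intro x
  rw [reflectionLinear_apply, reflectionLinear_apply, QuadraticMap.polar_add_left,
    QuadraticMap.polar_smul_left, polar_self_zmod_two, smul_zero, add_zero, add_assoc,
    add_self_eq_zero_of_zmod_two, add_zero]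

/-- The reflection in a nonsingular vector `v`. -/
noncomputable def reflection (v : V) (hv : q v = 1) : orthogonalGroup q :=
  ⟨LinearEquiv.ofInvolutive (reflectionLinear q v) (reflectionLinear_involutive v), fun x => by
    change q (reflectionLinear q v x) = q x
    rw [reflectionLinear_apply]
    rcases zmod_two_cases (QuadraticMap.polar q x v) with h | h
    · rw [h, zero_smul, add_zero]
    · rw [map_add_eq, h, one_smul, hv, h, add_assoc, CharTwo.add_self_eq_zero, add_zero]⟩

theorem reflection_apply (v : V) (hv : q v = 1) (x : V) :
    (reflection v hv : V ≃ₗ[ZMod 2] V) x = x + QuadraticMap.polar q x v • v := rfl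

theorem reflection_mul_self (v : V) (hv : q v = 1) : reflection v hv * reflection v hv = 1 := by
  apply Subtype.ext
  ext x
  exact reflectionLinear_involutive v x

/-- The space of fixed vectors of an orthogonal transformation. -/
def fixedSpace (u : orthogonalGroup q) : Submodule (ZMod 2) V :=
  LinearMap.ker ((u : V ≃ₗ[ZMod 2] V).toLinearMap - LinearMap.id)

theorem mem_fixedSpace {u : orthogonalGroup q} {x : V} :
    x ∈ fixedSpace u ↔ (u : V ≃ₗ[ZMod 2] V) x = x := by
  rw [fixedSpace, LinearMap.mem_ker, LinearMap.sub_apply, sub_eq_zero]; rfl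

variable [Module.Finite (ZMod 2) V]

theorem dicksonInvariant_eq (u : orthogonalGroup q) :
    dicksonInvariant u = Module.finrank (ZMod 2) V + Module.finrank (ZMod 2) (fixedSpace u) := by
  rw [← LinearMap.finrank_range_add_finrank_ker
    ((u : V ≃ₗ[ZMod 2] V).toLinearMap - LinearMap.id), Nat.cast_add, fixedSpace, add_assoc,
    CharTwo.add_self_eq_zero, add_zero, dicksonInvariant]

/-- The image of `u - 1` is the full orthogonal complement of the fixed space: if `u x = x`, then
`x` is orthogonal to `u y - y` because `u` preserves the polar form, and the dimensions agree by
nondegeneracy. -/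
theorem mem_range_of_orthogonal_fixedSpace (hq : (QuadraticMap.polarBilin q).Nondegenerate)
    (u : orthogonalGroup q) (v : V) (h : ∀ x ∈ fixedSpace u, QuadraticMap.polar q x v = 0) :
    ∃ y, (u : V ≃ₗ[ZMod 2] V) y = y + v := by
  set f := (u : V ≃ₗ[ZMod 2] V).toLinearMap - LinearMap.id with hf
  have hle : LinearMap.range f ≤ LinearMap.BilinForm.orthogonal (QuadraticMap.polarBilin q)
      (fixedSpace u) := by
    rintro _ ⟨y, rfl⟩
    rw [LinearMap.BilinForm.mem_orthogonal_iff]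
    intro x hx
    change QuadraticMap.polar q x ((u : V ≃ₗ[ZMod 2] V) y - y) = 0
    rw [QuadraticMap.polar_sub_right]
    nth_rewrite 1 [← mem_fixedSpace.1 hx]
    rw [polar_map, sub_self]
  have heq := Submodule.eq_of_le_of_finrank_eq hle (by
    rw [LinearMap.BilinForm.finrank_orthogonal hq, fixedSpace,
      ← LinearMap.finrank_range_add_finrank_ker f, Nat.add_sub_cancel])
  have hv : v ∈ LinearMap.range f := by
    rw [heq, LinearMap.BilinForm.mem_orthogonal_iff]
    exact h
  obtain ⟨y, hy⟩ := hv
  refine ⟨y, ?_⟩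
  rw [← hy, hf]
  simp

/-- The fixed spaces of `u` and of `reflection v hv * u` have the same intersection with the
hyperplane orthogonal to `v`, and exactly one of them lies inside that hyperplane. Their dimensions
therefore differ by one. -/
theorem dicksonInvariant_reflection_mul (hq : (QuadraticMap.polarBilin q).Nondegenerate) (v : V)
    (hv : q v = 1) (u : orthogonalGroup q) :
    dicksonInvariant (reflection v hv * u) = dicksonInvariant u + 1 := by
  set φ := (QuadraticMap.polarBilin q).flip v with hφ
  have hφx : ∀ x, φ x = QuadraticMap.polar q x v := fun _ => rfl
  have happ : ∀ x, ((reflection v hv * u : orthogonalGroup q) : V ≃ₗ[ZMod 2] V) x =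
    (u : V ≃ₗ[ZMod 2] V) x + QuadraticMap.polar q ((u : V ≃ₗ[ZMod 2] V) x) v • v := fun _ => rfl
  have hZ : fixedSpace (reflection v hv * u) ⊓ LinearMap.ker φ = fixedSpace u ⊓ LinearMap.ker φ := by
    ext x
    simp only [Submodule.mem_inf, mem_fixedSpace, LinearMap.mem_ker, hφx]
    refine and_congr_left fun hx => ?_
    constructor
    · intro h
      have h' := (reflectionLinear_involutive v ((u : V ≃ₗ[ZMod 2] V) x)).symm.trans
        (congrArg (reflectionLinear q v) h)
      rwa [reflectionLinear_apply v x, hx, zero_smul, add_zero] at h'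
    · intro h
      rw [happ, h, hx, zero_smul, add_zero]
  have hne : ∀ x, φ x ≠ 0 ↔ QuadraticMap.polar q x v = 1 := by
    intro x
    rw [hφx]
    rcases zmod_two_cases (QuadraticMap.polar q x v) with h | h <;> simp [h]
  -- Comparing `q (y + v)` with `q y` forces the polar term to cancel `q v = 1`.
  have hshift : ∀ y, (u : V ≃ₗ[ZMod 2] V) y = y + v → QuadraticMap.polar q y v = 1 := by
    intro y hy
    have := u.2 y
    rw [hy, map_add_eq, hv] at this
    linear_combination this - CharTwo.two_eq_zero (R := ZMod 2)
  rw [dicksonInvariant_eq, dicksonInvariant_eq, add_assoc]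
  congr 1
  by_cases h : ∃ x ∈ fixedSpace u, φ x ≠ 0
  · have h' : fixedSpace (reflection v hv * u) ⊓ LinearMap.ker φ =
        fixedSpace (reflection v hv * u) := by
      rw [inf_eq_left]
      intro y hy
      by_contra hy'
      have hy1 := (hne y).1 hy'
      obtain ⟨x, hx, hφ'⟩ := h
      rw [hne] at hφ'
      rw [mem_fixedSpace] at hx hy
      have hy2 : (u : V ≃ₗ[ZMod 2] V) y = y + v := by
        have h' := (reflectionLinear_involutive v ((u : V ≃ₗ[ZMod 2] V) y)).symm.trans
          (congrArg (reflectionLinear q v) hy)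
        rwa [reflectionLinear_apply v y, hy1, one_smul] at h'
      -- A vector `x` fixed by `u` and a `y` with `u y = y + v`, both nonorthogonal to `v`, would
      -- make `u` change their product by 1.
      have := polar_map u x y
      rw [hx, hy2, QuadraticMap.polar_add_right, hφ'] at this
      exact one_ne_zero (add_eq_left.1 this)
    rw [← h', hZ, ← finrank_inf_ker_add_one _ φ h, Nat.cast_add, Nat.cast_one, add_assoc,
      CharTwo.add_self_eq_zero, add_zero]
  · have h' : fixedSpace u ⊓ LinearMap.ker φ = fixedSpace u := by
      rw [inf_eq_left]
      intro x hx
      by_contra hx'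
      exact h ⟨x, hx, hx'⟩
    -- If `v` is orthogonal to the fixed space of `u`, then `v = u y - y` for some `y`, and the
    -- reflection returns `u y` to `y`: a new fixed vector outside the hyperplane.
    obtain ⟨y, hy⟩ := mem_range_of_orthogonal_fixedSpace hq u v fun x hx => by
      by_contra hx'
      exact h ⟨x, hx, hx'⟩
    have hy1 := hshift y hy
    have hy2 : y ∈ fixedSpace (reflection v hv * u) := by
      rw [mem_fixedSpace, happ, hy, QuadraticMap.polar_add_left, hy1, polar_self_zmod_two, add_zero,
        one_smul, add_assoc, add_self_eq_zero_of_zmod_two, add_zero]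
    rw [← finrank_inf_ker_add_one _ φ ⟨y, hy2, (hne y).2 hy1⟩, hZ, h', Nat.cast_add, Nat.cast_one]

end Reflection


/-! ### The orthogonal group of `Q` is generated by reflections -/

theorem pol_self (v : C) : pol v v = 0 := by
  have := quad_add v v
  rwa [C_add_self, quad_zero, CharTwo.add_self_eq_zero, zero_add, eq_comm] at this

theorem eq_zero_of_pol {v : C} (h : ∀ w, pol v w = 0) : v = 0 := by
  have h1 := h ((1, 0, 0), 0)
  have h2 := h ((0, 1, 0), 0)
  have h3 := h ((0, 0, 1), 0)
  have h4 := h (0, (1, 0, 0))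
  have h5 := h (0, (0, 1, 0))
  have h6 := h (0, (0, 0, 1))
  simp only [pol, dot] at h1 h2 h3 h4 h5 h6
  ext <;> simp_all

theorem eq_zero_of_pol_chain (v : C) : (∀ i, pol v (chain i) = 0) → v = 0 := by
  refine forall_of_code (p := fun v => (∀ i, pol v (chain i) = 0) → v = 0)
    (q := fun n => n == 0 || (List.range 6).any fun i => polN n (chainN[i]!) == 1)
    (by decide +kernel) (fun v h hv => ?_) v
  simp only [Bool.or_eq_true, beq_iff_eq, code_eq_zero, List.any_eq_true, List.mem_range] at h
  refine h.resolve_right ?_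
  rintro ⟨i, hi, h⟩
  have := (pol_eq_zero_iff _ _).1 (hv ⟨i, hi⟩)
  rw [code_chain] at this
  exact zero_ne_one (this.symm.trans h)

theorem nondegenerate_polarBilin_Q : (QuadraticMap.polarBilin Q).Nondegenerate := by
  have h : ∀ x : A, (∀ y, QuadraticMap.polar Q x y = 0) → x = 0 := by
    intro x hx
    obtain ⟨v, rfl⟩ := coord.surjective x
    rw [eq_zero_of_pol fun w => (polar_coord v w).symm.trans (hx _), map_zero]
  exact ⟨h, fun y hy => h y fun x => (QuadraticMap.polar_comm _ _ _).trans (hy x)⟩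

theorem ext_coord {u u' : orthogonalGroup Q}
    (h : ∀ c, (u : A ≃ₗ[ZMod 2] A) (coord c) = (u' : A ≃ₗ[ZMod 2] A) (coord c)) : u = u' := by
  apply Subtype.ext
  ext x
  obtain ⟨v, rfl⟩ := coord.surjective x
  exact h v

/-- The reflection of `A` in the nonsingular vector with coordinates `v`. -/
noncomputable def refl (v : C) (hv : quad v = 1) : orthogonalGroup Q :=
  reflection (coord v) (by rw [Q_coord, hv])

theorem refl_coord (v : C) (hv : quad v = 1) (c : C) :
    (refl v hv : A ≃ₗ[ZMod 2] A) (coord c) = coord (reflC v c) := by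
  rw [refl, reflection_apply, polar_coord, reflC, map_add, map_smul]

theorem refl_mul_self (v : C) (hv : quad v = 1) : refl v hv * refl v hv = 1 :=
  reflection_mul_self _ _

theorem quad_chain : ∀ k, quad (chain k) = 1 := by decide +kernel

/-- Composing with reflections makes `u` fix the vectors of `chain` one by one without disturbing
those already fixed. Once all six are fixed, `u` is the identity, since only 0 is orthogonal to the
whole chain. -/
theorem closure_refl_eq_top :
    Subgroup.closure {u : orthogonalGroup Q | ∃ v, ∃ hv : quad v = 1, u = refl v hv} = ⊤ := by
  set G := Subgroup.closure {u : orthogonalGroup Q | ∃ v, ∃ hv : quad v = 1, u = refl v hv} with hG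
  have hrefl : ∀ v, v = 0 ∨ quad v = 1 → ∃ g ∈ G, ∀ c,
      (g : A ≃ₗ[ZMod 2] A) (coord c) = coord (reflC v c) := by
    rintro v (rfl | hv)
    · refine ⟨1, G.one_mem, fun c => ?_⟩
      rw [reflC, smul_zero, add_zero]; rfl
    · exact ⟨refl v hv, Subgroup.subset_closure ⟨v, hv, rfl⟩, refl_coord v hv⟩
  have hfix : ∀ v c : C, pol c v = 0 → reflC v c = c := fun v c h => by
    rw [reflC, h, zero_smul, add_zero]
  -- `n` chain vectors are already fixed and `m` remain; the induction is on `m`.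
  have key : ∀ m n : ℕ, m + n = 6 → ∀ u : orthogonalGroup Q, (∀ i : Fin 6, (i : ℕ) < n →
      (u : A ≃ₗ[ZMod 2] A) (coord (chain i)) = coord (chain i)) → u ∈ G := by
    intro m
    induction m with
    | zero =>
      intro n hn u hu
      have : u = 1 := by
        refine ext_coord fun c => ?_
        obtain ⟨d, hd⟩ := coord.surjective ((u : A ≃ₗ[ZMod 2] A) (coord c))
        change _ = coord c
        rw [← hd]
        congr 1
        rw [← sub_eq_zero]
        refine eq_zero_of_pol_chain _ fun i => ?_
        rw [sub_eq_add_neg, CharTwo.neg_eq, pol_add_left, ← polar_coord, ← polar_coord, hd]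
        nth_rewrite 1 [← hu i (by omega)]
        rw [polar_map, CharTwo.add_self_eq_zero]
      exact this ▸ G.one_mem
    | succ m ih =>
      intro n hn u hu
      let k : Fin 6 := ⟨n, by omega⟩
      obtain ⟨y, hy⟩ := coord.surjective ((u : A ≃ₗ[ZMod 2] A) (coord (chain k)))
      have hlt : ∀ i : Fin 6, (i : ℕ) < n + 1 → i < k ∨ i = k := by
        intro i hi
        rcases Nat.lt_succ_iff_lt_or_eq.1 hi with h | h
        · exact Or.inl h
        · exact Or.inr (Fin.ext h)
      obtain ⟨v, hv, hv1, hv2⟩ := exists_reflections_to_chain k y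
        (by rw [← Q_coord, hy, u.2, Q_coord, quad_chain]) (fun i hi => ⟨fun h => by
          rw [h] at hy
          have := coord.injective ((u : A ≃ₗ[ZMod 2] A).injective ((hu i hi).trans hy))
          have hinj : Function.Injective chain := by decide +kernel
          exact hi.ne (hinj this), by
          rw [← polar_coord, hy, ← hu i hi, polar_map, polar_coord]⟩)
      obtain ⟨g, hg, hgc⟩ := hrefl v hv
      rcases hv2 with h | ⟨h1, h2, h3⟩
      · have := ih (n + 1) (by omega) (g * u) (fun i hi => by
          change (g : A ≃ₗ[ZMod 2] A) ((u : A ≃ₗ[ZMod 2] A) (coord (chain i))) = _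
          rcases hlt i hi with h' | rfl
          · rw [hu i h', hgc, hfix _ _ (hv1 i h')]
          · rw [← hy, hgc, h])
        exact (G.mul_mem_cancel_left hg).1 this
      · obtain ⟨g', hg', hgc'⟩ := hrefl (reflC v y + chain k) (Or.inr h1)
        have := ih (n + 1) (by omega) (g' * (g * u)) (fun i hi => by
          change (g' : A ≃ₗ[ZMod 2] A) ((g : A ≃ₗ[ZMod 2] A)
            ((u : A ≃ₗ[ZMod 2] A) (coord (chain i)))) = _
          rcases hlt i hi with h' | rfl
          · rw [hu i h', hgc, hfix _ _ (hv1 i h'), hgc', hfix _ _ (h2 i h')]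
          · rw [← hy, hgc, hgc']
            congr 1
            rw [reflC, pol_add_right, pol_self, h3, zero_add, one_smul, ← add_assoc, C_add_self,
              zero_add])
        exact (G.mul_mem_cancel_left hg).1 ((G.mul_mem_cancel_left hg').1 this)
  rw [eq_top_iff]
  intro u _
  exact key 6 0 rfl u fun i hi => absurd hi (Nat.not_lt_zero _)

/-! ### The Dickson invariant is a homomorphism -/

theorem dicksonInvariant_refl_mul (v : C) (hv : quad v = 1) (u : orthogonalGroup Q) :
    dicksonInvariant (refl v hv * u) = dicksonInvariant u + 1 :=
  dicksonInvariant_reflection_mul nondegenerate_polarBilin_Q _ _ u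

theorem dicksonInvariant_one : dicksonInvariant (1 : orthogonalGroup Q) = 0 := by
  have : ((1 : orthogonalGroup Q) : A ≃ₗ[ZMod 2] A).toLinearMap - LinearMap.id = 0 := by
    rw [sub_eq_zero]; rfl
  rw [dicksonInvariant, this, LinearMap.range_zero, finrank_bot, Nat.cast_zero]

/-- Induction on the number of reflections in a factorization of an orthogonal transformation. -/
theorem refl_induction {p : orthogonalGroup Q → Prop} (one : p 1)
    (mul : ∀ v hv u, p u → p (refl v hv * u)) (u : orthogonalGroup Q) : p u := by
  have hu : u ∈ Subgroup.closure {u : orthogonalGroup Q | ∃ v, ∃ hv : quad v = 1, u = refl v hv} := by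
    rw [closure_refl_eq_top]; trivial
  induction hu using Subgroup.closure_induction_left with
  | one => exact one
  | mul_left x hx y _ h =>
    obtain ⟨v, hv, rfl⟩ := hx
    exact mul v hv y h
  | inv_mul_cancel x hx y _ h =>
    obtain ⟨v, hv, rfl⟩ := hx
    rw [inv_eq_of_mul_eq_one_left (refl_mul_self v hv)]
    exact mul v hv y h

/-- The Dickson invariant as a homomorphism. -/
noncomputable def dicksonHom : orthogonalGroup Q →* Multiplicative (ZMod 2) where
  toFun u := Multiplicative.ofAdd (dicksonInvariant u)
  map_one' := by rw [dicksonInvariant_one]; rfl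
  map_mul' u u' := by
    rw [← ofAdd_add]
    congr 1
    induction u using refl_induction with
    | one => rw [one_mul, dicksonInvariant_one, zero_add]
    | mul v hv u h =>
      rw [mul_assoc, dicksonInvariant_refl_mul, dicksonInvariant_refl_mul, h]
      ring

theorem mem_ker_dicksonHom {u : orthogonalGroup Q} :
    u ∈ dicksonHom.ker ↔ dicksonInvariant u = 0 := Iff.rfl

/-- With `k` nonsingular and orthogonal to the plane, the Siegel transformation is the product of
the reflections in `k`, `k + v`, `k + w` and `k + v + w`, an even number. -/
theorem dicksonInvariant_of_siegelC {v w : C} (hvw : IsLine v w) {u : orthogonalGroup Q}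
    (hu : ∀ c, (u : A ≃ₗ[ZMod 2] A) (coord c) = coord (siegelC v w c)) :
    dicksonInvariant u = 0 := by
  obtain ⟨k, hk, hkv, hkw⟩ := exists_nonsingular_orthogonal v w hvw
  obtain ⟨-, -, -, hv, hw, hp⟩ := hvw
  have h1 : quad (k + v) = 1 := by rw [quad_add, hk, hv, hkv, add_zero, add_zero]
  have h2 : quad (k + w) = 1 := by rw [quad_add, hk, hw, hkw, add_zero, add_zero]
  have h3 : quad (k + v + w) = 1 := by
    rw [quad_add, h1, hw, pol_add_left, hkw, hp, add_zero, add_zero, add_zero]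
  have : u = refl k hk * (refl (k + v) h1 * (refl (k + w) h2 * (refl (k + v + w) h3 * 1))) := by
    refine ext_coord fun c => ?_
    rw [mul_one, hu]
    change _ = (refl k hk : A ≃ₗ[ZMod 2] A) ((refl (k + v) h1 : A ≃ₗ[ZMod 2] A)
      ((refl (k + w) h2 : A ≃ₗ[ZMod 2] A) ((refl (k + v + w) h3 : A ≃ₗ[ZMod 2] A) (coord c))))
    rw [refl_coord, refl_coord, refl_coord, refl_coord]
    congr 1
    have hvk := (pol_comm v k).trans hkv
    have hwk := (pol_comm w k).trans hkw
    have hwv := (pol_comm w v).trans hp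
    simp only [reflC, siegelC, pol_add_left, pol_add_right]
    have hsmul : ∀ (a : ZMod 2) (x y : C), pol (a • x) y = a * pol x y := by
      intro a x y; simp only [pol, dot, Prod.smul_fst, Prod.smul_snd, smul_eq_mul]; ring
    simp only [hsmul, pol_add_left, pol_self, hkv, hkw, hp, hvk, hwk, hwv,
      add_zero, mul_zero]
    have h2 : (2 : C) = 0 := rfl
    generalize pol c k = α
    generalize pol c v = β
    generalize pol c w = γ
    clear * - h2
    rcases zmod_two_cases α with rfl | rfl <;> rcases zmod_two_cases β with rfl | rfl <;>
      rcases zmod_two_cases γ with rfl | rfl <;>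
      simp [show (1 + 1 : ZMod 2) = 0 from rfl] <;> grind
  rw [this, dicksonInvariant_refl_mul, dicksonInvariant_refl_mul, dicksonInvariant_refl_mul,
    dicksonInvariant_refl_mul, dicksonInvariant_one]
  decide


/-! ### The action of `SL₄(2)` on alternating matrices -/

/-- The group `SL₄(2)`. -/
abbrev SL4 : Type := Matrix.SpecialLinearGroup (Fin 4) (ZMod 2)

/-- A matrix of determinant one as an element of `SL₄(2)`. -/
def toSL4 (M : Matrix (Fin 4) (Fin 4) (ZMod 2)) (h : M.det = 1) : SL4 := ⟨M, h⟩

@[simp] theorem coe_toSL4 (M : Matrix (Fin 4) (Fin 4) (ZMod 2)) (h : M.det = 1) :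
    (toSL4 M h : Matrix (Fin 4) (Fin 4) (ZMod 2)) = M := rfl

/-- The transformation `M ↦ g M gᵀ` of alternating matrices, in coordinates. -/
def slC (g : SL4) (v : C) : C :=
  altCoord ((g : Matrix (Fin 4) (Fin 4) (ZMod 2)) * alt v * (g : Matrix (Fin 4) (Fin 4) (ZMod 2))ᵀ)

theorem alt_slC (g : SL4) (v : C) : alt (slC g v) =
    (g : Matrix (Fin 4) (Fin 4) (ZMod 2)) * alt v * (g : Matrix (Fin 4) (Fin 4) (ZMod 2))ᵀ := by
  obtain ⟨T, hT⟩ := exists_alt_eq v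
  have := alt_altCoord ((g : Matrix (Fin 4) (Fin 4) (ZMod 2)) * T *
    (g : Matrix (Fin 4) (Fin 4) (ZMod 2))ᵀ)
  rw [slC, hT]
  simp only [Matrix.transpose_mul, Matrix.transpose_transpose, ← Matrix.mul_assoc] at this
  simpa only [Matrix.mul_add, Matrix.add_mul] using this

theorem slC_one (v : C) : slC 1 v = v :=
  alt_injective (by simp [alt_slC])

theorem slC_mul (g g' : SL4) (v : C) : slC (g * g') v = slC g (slC g' v) :=
  alt_injective (by simp [alt_slC, Matrix.mul_assoc])

theorem slC_add (g : SL4) (v w : C) : slC g (v + w) = slC g v + slC g w :=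
  alt_injective (by simp only [alt_slC, alt_add, Matrix.mul_add, Matrix.add_mul])

theorem quad_slC (g : SL4) (v : C) : quad (slC g v) = quad v := by
  rw [← det_alt, alt_slC, Matrix.det_mul, Matrix.det_mul, Matrix.det_transpose, g.2, one_mul,
    mul_one, det_alt]

/-- The linear automorphism of the coordinate space given by an element of `SL₄(2)`. -/
def slLinear (g : SL4) : C ≃ₗ[ZMod 2] C :=
  { AddMonoidHom.toZModLinearMap 2 (AddMonoidHom.mk' (slC g) (slC_add g)) with
    invFun := slC g⁻¹
    left_inv := fun v => by
      change slC g⁻¹ (slC g v) = v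
      rw [← slC_mul, inv_mul_cancel, slC_one]
    right_inv := fun v => by
      change slC g (slC g⁻¹ v) = v
      rw [← slC_mul, mul_inv_cancel, slC_one] }

/-- The homomorphism from `SL₄(2)` to the orthogonal group of `Q`. -/
noncomputable def slHom : SL4 →* orthogonalGroup Q where
  toFun g := ⟨coord.symm.trans ((slLinear g).trans coord), fun x => by
    obtain ⟨v, rfl⟩ := coord.surjective x
    simp only [LinearEquiv.trans_apply, LinearEquiv.symm_apply_apply]
    exact (Q_coord _).trans ((quad_slC g v).trans (Q_coord v).symm)⟩
  map_one' := ext_coord fun c => by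
    simp only [LinearEquiv.trans_apply, LinearEquiv.symm_apply_apply]
    exact congrArg coord (slC_one c)
  map_mul' g g' := ext_coord fun c => by
    change coord (slC (g * g') (coord.symm (coord c))) =
      coord (slC g (coord.symm (coord (slC g' (coord.symm (coord c))))))
    simp only [LinearEquiv.symm_apply_apply, slC_mul]

theorem slHom_coord (g : SL4) (c : C) :
    (slHom g : A ≃ₗ[ZMod 2] A) (coord c) = coord (slC g c) := by
  change coord (slC g (coord.symm (coord c))) = _
  rw [LinearEquiv.symm_apply_apply]

/-- Fixing every `e_a∧e_b` prescribes all 2×2 minors of `g`. A nonzero off-diagonal entry would then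
make two columns dependent, and the minors on the diagonal force its entries to be 1. -/
theorem slHom_injective : Function.Injective slHom := by
  rw [injective_iff_map_eq_one]
  intro g hg
  have h1 : ∀ i j a b, (g i a * g j b + g i b * g j a : ZMod 2) =
      alt (wedge a b) i j := by
    intro i j a b
    have h : slC g (wedge a b) = wedge a b := by
      apply coord.injective
      rw [← slHom_coord, hg]; rfl
    rw [← h, alt_slC, alt_wedge, Matrix.mul_add, Matrix.add_mul]
    simp [Matrix.mul_apply, Matrix.single_apply, ite_and]
  have hoff : ∀ i a, i ≠ a → g i a = 0 := by
    intro i a hia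
    by_contra h0
    have h0' : g i a = 1 := (zmod_two_cases _).resolve_left h0
    -- For `i` outside `{a, b}` the whole row `i` of `e_a∧e_b` vanishes, so column `b` of `g` is a
    -- multiple of column `a`.
    obtain ⟨b, hb, hb'⟩ : ∃ b, b ≠ i ∧ b ≠ a := by
      clear * -
      revert i a; decide
    have hcol : ∀ j, g j b = g i b * g j a := by
      intro j
      have := h1 i j a b
      rw [h0', one_mul, alt_wedge] at this
      rw [Matrix.add_apply, Matrix.single_apply_of_row_ne hia.symm,
        Matrix.single_apply_of_row_ne hb, add_zero] at this
      exact (CharTwo.add_eq_zero).1 this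
    have hker : (g : Matrix (Fin 4) (Fin 4) (ZMod 2)) *ᵥ
        (Pi.single b 1 - g i b • Pi.single a 1) = 0 := by
      ext j
      simp [Matrix.mulVec_sub, Matrix.mulVec_smul, hcol j]
    have := Matrix.eq_zero_of_mulVec_eq_zero (by rw [g.2]; exact one_ne_zero) hker
    have := congrFun this b
    simp [hb'] at this
  apply Subtype.ext
  ext i j
  by_cases hij : i = j
  · subst hij
    obtain ⟨b, hb⟩ : ∃ b, b ≠ i := exists_ne i
    have := h1 i b i b
    rw [hoff i b hb.symm, zero_mul, add_zero, alt_wedge] at this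
    rw [Matrix.add_apply, Matrix.single_apply_same, Matrix.single_apply_of_row_ne hb, add_zero]
      at this
    rcases zmod_two_cases (g i i) with h | h
    · rw [h, zero_mul] at this
      exact absurd this zero_ne_one
    · simpa using h
  · rw [hoff i j hij]
    simp [hij]

theorem refl_mul_refl_mem_range (v w : C) (hv : quad v = 1) (hw : quad w = 1) :
    refl v hv * refl w hw ∈ slHom.range := by
  refine ⟨toSL4 (alt v * alt w.swap) ?_, ext_coord fun c => ?_⟩
  · rw [Matrix.det_mul, det_alt, det_alt, hv, quad_swap, hw, one_mul]
  · rw [slHom_coord]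
    change _ = (refl v hv : A ≃ₗ[ZMod 2] A) ((refl w hw : A ≃ₗ[ZMod 2] A) (coord c))
    rw [refl_coord, refl_coord]
    exact congrArg coord (alt_injective ((alt_slC _ _).trans (alt_reflC_reflC hv hw c)))

theorem mem_range_slHom_of_dicksonInvariant {u : orthogonalGroup Q}
    (hu : dicksonInvariant u = 0) : u ∈ slHom.range := by
  -- Odd elements are carried through the induction by the property that every further reflection
  -- brings them into the image.
  have key : ∀ u : orthogonalGroup Q, (dicksonInvariant u = 0 ∧ u ∈ slHom.range) ∨
      (dicksonInvariant u = 1 ∧ ∀ v hv, refl v hv * u ∈ slHom.range) := by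
    intro u
    induction u using refl_induction with
    | one => exact Or.inl ⟨dicksonInvariant_one, slHom.range.one_mem⟩
    | mul v hv u h =>
      rw [dicksonInvariant_refl_mul]
      rcases h with ⟨h1, h2⟩ | ⟨h1, h2⟩
      · refine Or.inr ⟨by rw [h1, zero_add], fun w hw => ?_⟩
        rw [← mul_assoc]
        exact slHom.range.mul_mem (refl_mul_refl_mem_range w v hw hv) h2
      · exact Or.inl ⟨by rw [h1]; rfl, h2 v hv⟩
  rcases key u with h | h
  · exact h.2
  · exact absurd (hu.symm.trans h.1) zero_ne_one

/-- Over `𝔽₂` the only invertible diagonal matrix is 1 and the only nontrivial transvection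
coefficient is 1, so the transvections with coefficient 1 suffice. -/
theorem SL4_induction {p : SL4 → Prop} (one : p 1)
    (transvection : ∀ (i j : Fin 4) (hij : i ≠ j), p (Matrix.SpecialLinearGroup.transvection hij 1))
    (mul : ∀ g g', p g → p g' → p (g * g')) (g : SL4) : p g := by
  have key : ∀ h, p (toSL4 (g : Matrix (Fin 4) (Fin 4) (ZMod 2)) h) := by
    refine Matrix.diagonal_transvection_induction
      (fun M => ∀ h, p (toSL4 M h)) _ (fun D _ h => ?_) (fun t h => ?_)
      (fun M M' hM hM' h => ?_)
    · have hD : Matrix.diagonal D = 1 := by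
        rw [Matrix.det_diagonal] at h
        rw [← Matrix.diagonal_one]
        congr 1
        ext i
        refine (zmod_two_cases (D i)).resolve_left fun h0 => ?_
        rw [Finset.prod_eq_zero (Finset.mem_univ i) h0] at h
        exact zero_ne_one h
      have : toSL4 (Matrix.diagonal D) h = 1 := Subtype.ext (by simpa using hD)
      rwa [this]
    · obtain ⟨i, j, hij, c⟩ := t
      rcases zmod_two_cases c with rfl | rfl
      · have : toSL4 _ h = 1 := Subtype.ext (by simp [Matrix.TransvectionStruct.toMatrix_mk])
        rwa [this]
      · exact transvection i j hij
    · have h' := h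
      rw [Matrix.det_mul] at h'
      have h1 : M.det = 1 := (zmod_two_cases _).resolve_left fun h0 => by
        rw [h0, zero_mul] at h'; exact zero_ne_one h'
      have h2 : M'.det = 1 := by linear_combination h' - M'.det * h1
      have : toSL4 (M * M') h = toSL4 M h1 * toSL4 M' h2 := Subtype.ext (by simp)
      rw [this]
      exact mul _ _ (hM h1) (hM' h2)
  exact key g.2

/-- The image of `SL₄(2)` is contained in any group that contains the Siegel transformations. -/
theorem range_slHom_le {S : Subgroup (orthogonalGroup Q)}
    (hS : ∀ v w, IsLine v w → ∀ u : orthogonalGroup Q,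
      (∀ c, (u : A ≃ₗ[ZMod 2] A) (coord c) = coord (siegelC v w c)) → u ∈ S) :
    slHom.range ≤ S := by
  rintro _ ⟨g, rfl⟩
  induction g using SL4_induction with
  | one => rw [map_one]; exact S.one_mem
  | transvection i j hij =>
    obtain ⟨v, w, hvw, h⟩ := exists_siegelC_eq_transvection i j hij
    refine hS v w hvw _ fun c => ?_
    rw [slHom_coord]
    exact congrArg coord (alt_injective ((alt_slC _ _).trans (h c).symm))
  | mul g g' hg hg' => rw [map_mul]; exact S.mul_mem hg hg'

theorem mem_range_slHom {u : orthogonalGroup Q} :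
    u ∈ slHom.range ↔ dicksonInvariant u = 0 :=
  ⟨fun h => mem_ker_dicksonHom.1 (range_slHom_le (S := dicksonHom.ker)
    (fun _ _ hvw _ hu => mem_ker_dicksonHom.2 (dicksonInvariant_of_siegelC hvw hu)) h),
    mem_range_slHom_of_dicksonInvariant⟩


/-! ### Involutions attached to pairs of commuting involutions -/

section Involution

variable {a b : Matrix Idx Idx ℝ}

/-- The involution whose `(-1)`-eigenspace is the common `(-1)`-eigenspace of `a` and `b`. -/
noncomputable def rotM (a b : Matrix Idx Idx ℝ) : Matrix Idx Idx ℝ :=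
  (1 / 2 : ℝ) • (1 + a + b - a * b)

/-- The projection to the common `(-1)`-eigenspace of `a` and `b`. -/
noncomputable def projM (a b : Matrix Idx Idx ℝ) : Matrix Idx Idx ℝ :=
  (1 / 4 : ℝ) • (1 - a - b + a * b)

theorem rotM_eq (a b : Matrix Idx Idx ℝ) : rotM a b = 1 - (2 : ℝ) • projM a b := by
  rw [rotM, projM]
  module

theorem mul_projM_left (ha : a * a = 1) : a * projM a b = -projM a b := by
  rw [projM, Matrix.mul_smul, ← smul_neg]
  congr 1
  simp only [mul_add, mul_sub, ← mul_assoc, ha, mul_one, one_mul]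
  abel

theorem mul_projM_right (hb : b * b = 1) (hab : a * b = b * a) : b * projM a b = -projM a b := by
  rw [projM, Matrix.mul_smul, ← smul_neg]
  congr 1
  have : b * (a * b) = a := by rw [hab, ← mul_assoc, hb, one_mul]
  simp only [mul_add, mul_sub, this, hb, mul_one, ← hab]
  abel

theorem projM_mul_self (ha : a * a = 1) (hb : b * b = 1) (hab : a * b = b * a) :
    projM a b * projM a b = projM a b := by
  nth_rewrite 1 [projM]
  rw [Matrix.smul_mul]
  simp only [Matrix.add_mul, Matrix.sub_mul, Matrix.mul_assoc, mul_projM_left ha,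
    mul_projM_right hb hab, Matrix.mul_neg, Matrix.one_mul, neg_neg]
  module

theorem rotM_mul_self (ha : a * a = 1) (hb : b * b = 1) (hab : a * b = b * a) :
    rotM a b * rotM a b = 1 := by
  rw [rotM_eq, Matrix.mul_sub, Matrix.sub_mul, Matrix.sub_mul]
  simp only [Matrix.smul_mul, Matrix.mul_smul, projM_mul_self ha hb hab, Matrix.one_mul,
    Matrix.mul_one]
  module

theorem rotM_transpose (ha : aᵀ = a) (hb : bᵀ = b) (hab : a * b = b * a) :
    (rotM a b)ᵀ = rotM a b := by
  simp only [rotM, Matrix.transpose_smul, Matrix.transpose_add, Matrix.transpose_sub,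
    Matrix.transpose_one, Matrix.transpose_mul, ha, hb, hab]

/-- This rule and the three anticommuting variants below cover all sign patterns. Conjugation by
`rotM a b` multiplies `k` by `b` if `k` anticommutes with `a` alone, by `a` if with `b` alone, and
by `-ab` if with both: a Siegel transformation on the level of matrices. -/
theorem rotM_mul_eq_of_comm (k : Matrix Idx Idx ℝ) (hka : k * a = a * k)
    (hkb : k * b = b * k) : rotM a b * k = k * rotM a b := by
  have h : k * (a * b) = a * b * k := by rw [← mul_assoc, hka, mul_assoc, hkb, mul_assoc]
  simp only [rotM, Matrix.smul_mul, Matrix.mul_smul, mul_add, mul_sub, add_mul, sub_mul, hka, hkb,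
    mul_one, one_mul, h]

theorem rotM_mul_eq_of_anticomm_left (hb : b * b = 1) (hab : a * b = b * a)
    (k : Matrix Idx Idx ℝ) (hka : k * a = -(a * k)) (hkb : k * b = b * k) :
    rotM a b * k = b * k * rotM a b := by
  have h1 : b * k * a = -(a * b * k) := by rw [mul_assoc, hka, mul_neg, ← mul_assoc, ← hab]
  have h2 : b * k * b = k := by rw [mul_assoc, hkb, ← mul_assoc, hb, one_mul]
  have h3 : b * k * (a * b) = -(a * k) := by
    rw [hab, ← mul_assoc, h2, hka]
  simp only [rotM, Matrix.smul_mul, Matrix.mul_smul, mul_add, mul_sub, add_mul, sub_mul, h1, h2, h3,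
    mul_one, one_mul]
  congr 1
  abel

theorem rotM_comm (hab : a * b = b * a) : rotM a b = rotM b a := by
  rw [rotM, rotM, hab, add_right_comm]

theorem rotM_mul_eq_of_anticomm_right (ha : a * a = 1) (hab : a * b = b * a)
    (k : Matrix Idx Idx ℝ) (hka : k * a = a * k) (hkb : k * b = -(b * k)) :
    rotM a b * k = a * k * rotM a b := by
  rw [rotM_comm hab]
  exact rotM_mul_eq_of_anticomm_left ha hab.symm k hkb hka

theorem rotM_mul_eq_of_anticomm (ha : a * a = 1) (hb : b * b = 1) (hab : a * b = b * a)
    (k : Matrix Idx Idx ℝ) (hka : k * a = -(a * k)) (hkb : k * b = -(b * k)) :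
    rotM a b * k = -(a * b * k * rotM a b) := by
  have h1 : a * b * k * a = -(b * k) := by
    rw [mul_assoc, hka, mul_neg, ← mul_assoc, hab, mul_assoc b, ha, mul_one]
  have h2 : a * b * k * b = -(a * k) := by
    rw [mul_assoc, hkb, mul_neg, ← mul_assoc, mul_assoc a, hb, mul_one]
  have h3 : a * b * k * (a * b) = k := by
    rw [← mul_assoc, h1, neg_mul, mul_assoc, hkb, mul_neg, neg_neg, ← mul_assoc, hb, one_mul]
  simp only [rotM, Matrix.smul_mul, Matrix.mul_smul, mul_add, mul_sub, add_mul, sub_mul, h1, h2, h3,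
    mul_one, one_mul]
  rw [← smul_neg]
  congr 1
  abel

/-- The matrix `k` restricts to a complex structure on the `(-1)`-eigenspace, so `rotM a b` has a
real square root. Its determinant is then a square, and it is `±1`. -/
theorem det_rotM (ha : a * a = 1) (hb : b * b = 1) (hab : a * b = b * a) (k : Matrix Idx Idx ℝ)
    (hka : k * a = a * k) (hkb : k * b = b * k) (hk : k * k = -1) : (rotM a b).det = 1 := by
  have hP := projM_mul_self ha hb hab
  have hPk : projM a b * k = k * projM a b := by
    have h : k * (a * b) = a * b * k := by rw [← mul_assoc, hka, mul_assoc, hkb, mul_assoc]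
    simp only [projM, Matrix.smul_mul, Matrix.mul_smul, mul_add, mul_sub, add_mul, sub_mul, hka,
      hkb, mul_one, one_mul, h]
  -- The root is the identity off the eigenspace and `k` on it, where `k * k = -1`.
  have hs : (1 - projM a b + projM a b * k) * (1 - projM a b + projM a b * k) = rotM a b := by
    have h1 : projM a b * k * projM a b = projM a b * k := by
      rw [mul_assoc, ← hPk, ← mul_assoc, hP]
    have h2 : projM a b * k * k = -projM a b := by rw [mul_assoc, hk, mul_neg, mul_one]
    rw [rotM_eq, two_smul]
    simp only [mul_add, mul_sub, add_mul, sub_mul, h1, h2, ← mul_assoc, hP, one_mul, mul_one]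
    abel
  have h1 : (rotM a b).det * (rotM a b).det = 1 := by
    rw [← Matrix.det_mul, rotM_mul_self ha hb hab, Matrix.det_one]
  rcases mul_self_eq_one_iff.1 h1 with h | h
  · exact h
  · rw [← hs, Matrix.det_mul] at h
    nlinarith [mul_self_nonneg (1 - projM a b + projM a b * k).det]

theorem projM_mulVec_eq_iff (ha : a * a = 1) (hb : b * b = 1) (hab : a * b = b * a)
    {x : Idx → ℝ} : projM a b *ᵥ x = x ↔ a *ᵥ x = -x ∧ b *ᵥ x = -x := by
  constructor
  · intro h
    constructor <;> nth_rewrite 1 [← h]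
    · rw [Matrix.mulVec_mulVec, mul_projM_left ha, Matrix.neg_mulVec, h]
    · rw [Matrix.mulVec_mulVec, mul_projM_right hb hab, Matrix.neg_mulVec, h]
  · rintro ⟨h1, h2⟩
    rw [projM, Matrix.smul_mulVec, Matrix.add_mulVec, Matrix.sub_mulVec, Matrix.sub_mulVec,
      ← Matrix.mulVec_mulVec, h2, Matrix.mulVec_neg, h1, Matrix.one_mulVec]
    module

theorem mem_eigenspace_rotM_neg_one {x : Idx → ℝ} :
    x ∈ Module.End.eigenspace (Matrix.toLin' (rotM a b)) (-1) ↔ projM a b *ᵥ x = x := by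
  rw [Module.End.mem_eigenspace_iff, Matrix.toLin'_apply, rotM_eq, Matrix.sub_mulVec,
    Matrix.smul_mulVec, Matrix.one_mulVec]
  constructor
  · intro h
    have : (2 : ℝ) • (projM a b *ᵥ x) = (2 : ℝ) • x := by
      rw [sub_eq_iff_eq_add] at h
      rw [eq_sub_of_add_eq' h.symm]
      module
    exact smul_right_injective _ (two_ne_zero (α := ℝ)) this
  · intro h
    rw [h]
    module

theorem mem_eigenspace_rotM_one {x : Idx → ℝ} :
    x ∈ Module.End.eigenspace (Matrix.toLin' (rotM a b)) 1 ↔ projM a b *ᵥ x = 0 := by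
  rw [Module.End.mem_eigenspace_iff, Matrix.toLin'_apply, rotM_eq, Matrix.sub_mulVec,
    Matrix.smul_mulVec, Matrix.one_mulVec, one_smul, sub_eq_self, smul_eq_zero]
  simp

theorem finrank_range_projM (ha : a * a = 1) (hb : b * b = 1) (hab : a * b = b * a)
    (ht : (projM a b).trace = 2) :
    Module.finrank ℝ (LinearMap.range (Matrix.toLin' (projM a b))) = 2 := by
  have h : LinearMap.IsProj (LinearMap.range (Matrix.toLin' (projM a b)))
      (Matrix.toLin' (projM a b)) :=
    ⟨fun x => LinearMap.mem_range_self _ x, by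
      rintro _ ⟨y, rfl⟩
      rw [← LinearMap.comp_apply, ← Matrix.toLin'_mul, projM_mul_self ha hb hab]⟩
  have := h.trace
  rw [Matrix.trace_toLin'_eq, ht] at this
  exact_mod_cast this.symm

theorem finrank_eigenspace_rotM_one (ha : a * a = 1) (hb : b * b = 1) (hab : a * b = b * a)
    (ht : (projM a b).trace = 2) :
    Module.finrank ℝ (Module.End.eigenspace (Matrix.toLin' (rotM a b)) 1) + 2
      = Fintype.card Idx := by
  have h : Module.End.eigenspace (Matrix.toLin' (rotM a b)) 1 =
      LinearMap.ker (Matrix.toLin' (projM a b)) := by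
    ext x
    rw [mem_eigenspace_rotM_one, LinearMap.mem_ker, Matrix.toLin'_apply]
  have h2 := LinearMap.finrank_range_add_finrank_ker (Matrix.toLin' (projM a b))
  rw [finrank_range_projM ha hb hab ht, Module.finrank_fintype_fun_eq_card] at h2
  rw [h, ← h2, add_comm]

theorem eigenspace_rotM_neg_one_ne_bot (ha : a * a = 1) (hb : b * b = 1) (hab : a * b = b * a)
    (ht : (projM a b).trace = 2) :
    Module.End.eigenspace (Matrix.toLin' (rotM a b)) (-1) ≠ ⊥ := by
  have h : Module.End.eigenspace (Matrix.toLin' (rotM a b)) (-1) =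
      LinearMap.range (Matrix.toLin' (projM a b)) := by
    ext x
    rw [mem_eigenspace_rotM_neg_one]
    constructor
    · intro h; exact ⟨x, h⟩
    · rintro ⟨y, rfl⟩
      rw [Matrix.toLin'_apply, Matrix.mulVec_mulVec, projM_mul_self ha hb hab]
  rw [h]
  intro h0
  have := finrank_range_projM ha hb hab ht
  rw [h0, finrank_bot] at this
  exact absurd this (by norm_num)

end Involution

/-- A symmetric involution is determined by its `(-1)`-eigenspace. -/
theorem eq_of_eigenspace_neg_one_eq {ι : Type*} [Fintype ι] [DecidableEq ι] {M N : Matrix ι ι ℝ}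
    (hM : Mᵀ = M) (hN : Nᵀ = N) (hM2 : M * M = 1) (hN2 : N * N = 1)
    (h : Module.End.eigenspace (Matrix.toLin' M) (-1) =
      Module.End.eigenspace (Matrix.toLin' N) (-1)) : M = N := by
  have key : ∀ X Y : Matrix ι ι ℝ, Y * Y = 1 → Module.End.eigenspace (Matrix.toLin' X) (-1) =
      Module.End.eigenspace (Matrix.toLin' Y) (-1) → X * (1 - Y) = -(1 - Y) := by
    intro X Y hY h
    apply Matrix.toLin'.injective
    ext1 j
    ext1
    simp only [LinearMap.comp_apply, Matrix.toLin'_mul, map_neg, LinearMap.neg_apply]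
    have hmem : ∀ x, Matrix.toLin' (1 - Y) x ∈ Module.End.eigenspace (Matrix.toLin' X) (-1) := by
      intro x
      rw [h, Module.End.mem_eigenspace_iff, ← LinearMap.comp_apply, ← Matrix.toLin'_mul,
        Matrix.mul_sub, Matrix.mul_one, hY, ← neg_sub, map_neg, neg_one_smul]
      rfl
    have := Module.End.mem_eigenspace_iff.1 (hmem (LinearMap.single ℝ (fun _ => ℝ) j 1))
    rwa [neg_one_smul] at this
  have h1 := key M N hN2 h
  have h2 := congrArg Matrix.transpose (key N M hM2 h.symm)
  rw [Matrix.transpose_mul, Matrix.transpose_neg, Matrix.transpose_sub, Matrix.transpose_one, hM,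
    hN, Matrix.sub_mul, Matrix.one_mul] at h2
  rw [Matrix.mul_sub, Matrix.mul_one] at h1
  have h3 : M - N = N - M := by
    calc M - N = (M - M * N) - (N - M * N) := by abel
      _ = N - M := by rw [h1, h2]; abel
  have h4 : (2 : ℝ) • M = (2 : ℝ) • N := by
    rw [two_smul, two_smul]
    exact sub_eq_sub_iff_add_eq_add.1 h3
  exact smul_right_injective _ (two_ne_zero (α := ℝ)) h4


/-! ### Signed Heisenberg matrices -/

/-- The matrix `heis v` with a sign. -/
noncomputable def sheis (s : ZMod 2) (v : C) : Matrix Idx Idx ℝ := sgn ℝ s • heis ℝ v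

theorem sheis_mul_self {s : ZMod 2} {v : C} (hv : quad v = 0) : sheis s v * sheis s v = 1 := by
  rw [sheis, Matrix.smul_mul, Matrix.mul_smul, heis_mul_self, hv, sgn_zero, one_smul, smul_smul,
    sgn_mul_self, one_smul]

theorem sheis_transpose {s : ZMod 2} {v : C} (hv : quad v = 0) : (sheis s v)ᵀ = sheis s v := by
  rw [sheis, Matrix.transpose_smul, heis_transpose, hv, sgn_zero, one_smul]

theorem heis_mul_sheis (u v : C) (s : ZMod 2) :
    heis ℝ u * sheis s v = sgn ℝ (pol u v) • (sheis s v * heis ℝ u) := by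
  rw [sheis, Matrix.mul_smul, Matrix.smul_mul, heis_mul_comm, smul_comm]

theorem sheis_mul_sheis (s t : ZMod 2) (v w : C) :
    sheis s v * sheis t w = sheis (s + t + dot v.2 w.1) (v + w) := by
  rw [sheis, sheis, Matrix.smul_mul, Matrix.mul_smul, heis_mul, smul_smul, smul_smul, ← sgn_add,
    ← sgn_add, sheis, add_assoc]

theorem sheis_mul_comm {s t : ZMod 2} {v w : C} (h : pol v w = 0) :
    sheis s v * sheis t w = sheis t w * sheis s v := by
  nth_rewrite 1 [sheis]
  rw [Matrix.smul_mul, heis_mul_sheis, h, sgn_zero, one_smul, ← Matrix.mul_smul]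
  rfl

theorem trace_sheis {s : ZMod 2} {v : C} (hv : v ≠ 0) : (sheis s v).trace = 0 := by
  rw [sheis, Matrix.trace_smul, trace_heis, if_neg hv, smul_zero]

theorem sheis_eq (s : ZMod 2) (v : C) : heis ℝ v = sgn ℝ s • sheis s v := by
  rw [sheis, smul_smul, sgn_mul_self, one_smul]

theorem add_ne_zero_of_isLine {v w : C} (h : IsLine v w) : v + w ≠ 0 := fun h0 =>
  h.2.2.1 (CharTwo.add_eq_zero.1 h0)

/-- Only the identity term has nonzero trace, giving 8 / 4. As the trace of a projection is its
rank, weight spaces of singular planes are two-dimensional. -/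
theorem trace_projM_sheis {v w : C} (h : IsLine v w) (s t : ZMod 2) :
    (projM (sheis s v) (sheis t w)).trace = 2 := by
  rw [projM, sheis_mul_sheis, Matrix.trace_smul, Matrix.trace_add, Matrix.trace_sub,
    Matrix.trace_sub, trace_sheis h.1, trace_sheis h.2.1, trace_sheis (add_ne_zero_of_isLine h),
    Matrix.trace_one]
  norm_num

/-! ### The rotations attached to singular planes -/

/-- The matrix of the involution attached to a singular plane and a choice of signs. -/
noncomputable def lineM (v w : C) (s t : ZMod 2) : Matrix Idx Idx ℝ :=
  rotM (sheis s v) (sheis t w)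

theorem lineM_mul_self {v w : C} (h : IsLine v w) (s t : ZMod 2) :
    lineM v w s t * lineM v w s t = 1 :=
  rotM_mul_self (sheis_mul_self h.2.2.2.1) (sheis_mul_self h.2.2.2.2.1)
    (sheis_mul_comm h.2.2.2.2.2)

theorem lineM_transpose {v w : C} (h : IsLine v w) (s t : ZMod 2) :
    (lineM v w s t)ᵀ = lineM v w s t :=
  rotM_transpose (sheis_transpose h.2.2.2.1) (sheis_transpose h.2.2.2.2.1)
    (sheis_mul_comm h.2.2.2.2.2)

theorem det_lineM {v w : C} (h : IsLine v w) (s t : ZMod 2) : (lineM v w s t).det = 1 := by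
  obtain ⟨k, hk, hkv, hkw⟩ := exists_nonsingular_orthogonal v w h
  refine det_rotM (sheis_mul_self h.2.2.2.1) (sheis_mul_self h.2.2.2.2.1)
    (sheis_mul_comm h.2.2.2.2.2) (heis ℝ k) ?_ ?_ ?_
  · rw [heis_mul_sheis, hkv, sgn_zero, one_smul]
  · rw [heis_mul_sheis, hkw, sgn_zero, one_smul]
  · rw [heis_mul_self, hk, sgn_one, neg_one_smul]

theorem trace_lineM {v w : C} (h : IsLine v w) (s t : ZMod 2) : (lineM v w s t).trace = 4 := by
  rw [lineM, rotM_eq, Matrix.trace_sub, Matrix.trace_smul, trace_projM_sheis h, Matrix.trace_one]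
  norm_num

/-- The rotation attached to a singular plane and a choice of signs. -/
noncomputable def lineRot {v w : C} (h : IsLine v w) (s t : ZMod 2) : SO8 := ⟨lineM v w s t, by
  rw [Matrix.mem_specialOrthogonalGroup_iff, Matrix.mem_orthogonalGroup_iff]
  refine ⟨?_, det_lineM h s t⟩
  change lineM v w s t * (lineM v w s t)ᵀ = 1
  rw [lineM_transpose h, lineM_mul_self h]⟩

theorem coe_lineRot {v w : C} (h : IsLine v w) (s t : ZMod 2) :
    (lineRot h s t : Matrix Idx Idx ℝ) = lineM v w s t := rfl

theorem lineRot_mul_self {v w : C} (h : IsLine v w) (s t : ZMod 2) :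
    lineRot h s t * lineRot h s t = 1 :=
  Subtype.ext (lineM_mul_self h s t)

theorem orderOf_lineRot {v w : C} (h : IsLine v w) (s t : ZMod 2) :
    orderOf (lineRot h s t) = 2 := by
  refine orderOf_eq_prime (by rw [pow_two, lineRot_mul_self]) fun h1 => ?_
  have h2 : lineM v w s t = 1 := congrArg Subtype.val h1
  have h3 := trace_lineM h s t
  rw [h2, Matrix.trace_one] at h3
  norm_num at h3

theorem isRotation_lineRot {v w : C} (h : IsLine v w) (s t : ZMod 2) : IsRotation (lineRot h s t) :=
  finrank_eigenspace_rotM_one (sheis_mul_self h.2.2.2.1) (sheis_mul_self h.2.2.2.2.1)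
    (sheis_mul_comm h.2.2.2.2.2) (trace_projM_sheis h s t)

/-- An element of the preimage of a singular plane acts as a scalar on the weight spaces of
the plane. -/
theorem exists_mat_mul_projM_eq_smul {v w : C} (h : IsLine v w) (s t : ZMod 2) {x : H}
    (hx : cls x ∈ Submodule.span (ZMod 2) {coord v, coord w}) :
    ∃ c : ℝ, mat x * projM (sheis s v) (sheis t w) = c • projM (sheis s v) (sheis t w) := by
  have hv : heis ℝ v * projM (sheis s v) (sheis t w) =
      (-sgn ℝ s) • projM (sheis s v) (sheis t w) := by
    rw [sheis_eq s, Matrix.smul_mul, mul_projM_left (sheis_mul_self h.2.2.2.1), smul_neg, neg_smul]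
  have hw : heis ℝ w * projM (sheis s v) (sheis t w) =
      (-sgn ℝ t) • projM (sheis s v) (sheis t w) := by
    rw [sheis_eq t, Matrix.smul_mul, mul_projM_right (sheis_mul_self h.2.2.2.2.1)
      (sheis_mul_comm h.2.2.2.2.2), smul_neg, neg_smul]
  have hsmul : ∀ (α : ZMod 2) (u : C) (P : Matrix Idx Idx ℝ), (∃ c : ℝ, heis ℝ u * P = c • P) →
      ∃ c : ℝ, heis ℝ (α • u) * P = c • P := by
    intro α u P hu
    rcases zmod_two_cases α with rfl | rfl
    · exact ⟨1, by rw [zero_smul, heis_zero, Matrix.one_mul, one_smul]⟩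
    · rwa [one_smul]
  obtain ⟨α, β, hαβ⟩ := Submodule.mem_span_pair.1 hx
  rw [← map_smul, ← map_smul, ← map_add] at hαβ
  obtain ⟨ε, hε⟩ := cls_eq_coord'.1 hαβ.symm
  obtain ⟨c, hc⟩ := hsmul α v _ ⟨_, hv⟩
  obtain ⟨d, hd⟩ := hsmul β w _ ⟨_, hw⟩
  have hadd : heis ℝ (α • v + β • w) =
      sgn ℝ (dot (α • v).2 (β • w).1) • (heis ℝ (α • v) * heis ℝ (β • w)) := by
    rw [heis_mul, smul_smul, sgn_mul_self, one_smul]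
  refine ⟨sgn ℝ ε * (sgn ℝ (dot (α • v).2 (β • w).1) * (d * c)), ?_⟩
  rw [hε, hadd, Matrix.smul_mul, Matrix.smul_mul, Matrix.mul_assoc, hd, Matrix.mul_smul, hc,
    smul_smul, smul_smul, smul_smul]
  congr 1
  ring

theorem isSingular_span {v w : C} (h : IsLine v w) :
    IsSingular (Submodule.span (ZMod 2) {coord v, coord w}) := by
  intro x hx
  obtain ⟨α, β, rfl⟩ := Submodule.mem_span_pair.1 hx
  rw [← map_smul, ← map_smul, ← map_add, Q_coord]
  rcases zmod_two_cases α with rfl | rfl <;> rcases zmod_two_cases β with rfl | rfl <;>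
    simp [quad_zero, quad_add, h.2.2.2.1, h.2.2.2.2.1, h.2.2.2.2.2]

theorem finrank_span_coord {v w : C} (h : IsLine v w) :
    Module.finrank (ZMod 2) (Submodule.span (ZMod 2) {coord v, coord w}) = 2 := by
  have hli : LinearIndependent (ZMod 2) ![coord v, coord w] := by
    rw [LinearIndependent.pair_iff]
    intro α β hαβ
    rw [← map_smul, ← map_smul, ← map_add, LinearEquiv.map_eq_zero_iff] at hαβ
    rcases zmod_two_cases α with rfl | rfl <;> rcases zmod_two_cases β with rfl | rfl
    · exact ⟨rfl, rfl⟩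
    · exact absurd (by simpa using hαβ) h.2.1
    · exact absurd (by simpa using hαβ) h.1
    · exact absurd (by simpa using hαβ) (add_ne_zero_of_isLine h)
  have := finrank_span_eq_card hli
  rwa [Matrix.range_cons, Matrix.range_cons, Matrix.range_empty, Set.union_empty,
    Set.singleton_union, Fintype.card_fin] at this

theorem lineRot_mem_R₂ {v w : C} (h : IsLine v w) (s t : ZMod 2) : lineRot h s t ∈ R₂ := by
  have ha := sheis_mul_self (s := s) h.2.2.2.1
  have hb := sheis_mul_self (s := t) h.2.2.2.2.1
  have hab := sheis_mul_comm (s := s) (t := t) h.2.2.2.2.2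
  have htr := trace_projM_sheis h s t
  refine ⟨orderOf_lineRot h s t, eigenspace_rotM_neg_one_ne_bot ha hb hab htr,
    Submodule.span (ZMod 2) {coord v, coord w}, isSingular_span h, finrank_span_coord h, ?_⟩
  set P := projM (sheis s v) (sheis t w) with hP
  -- Since `P` has trace 2, the scalar by which `x` acts on its image is half the trace of `mat x *
  -- P`. This formula defines the character `χ` without choices.
  have hscal : ∀ x : preimage (Submodule.span (ZMod 2) {coord v, coord w}),
      mat x * P = ((mat x * P).trace / 2) • P := by
    intro x
    obtain ⟨c, hc⟩ := exists_mat_mul_projM_eq_smul h s t x.2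
    rw [hc, Matrix.trace_smul, htr, smul_eq_mul, mul_div_cancel_right₀ _ two_ne_zero]
  let χ : preimage (Submodule.span (ZMod 2) {coord v, coord w}) →* ℝ :=
    { toFun := fun x => (mat x * P).trace / 2
      map_one' := by
        change (mat 1 * P).trace / 2 = 1
        rw [mat_one, Matrix.one_mul, htr, div_self two_ne_zero]
      map_mul' := fun x y => by
        have hxy : mat ((x : H) * (y : H)) * P = ((mat y * P).trace / 2) • (mat x * P) := by
          rw [mat_mul, Matrix.mul_assoc, ← Matrix.mul_smul, ← hscal y]
        change (mat ((x : H) * (y : H)) * P).trace / 2 =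
          (mat x * P).trace / 2 * ((mat y * P).trace / 2)
        rw [hxy, Matrix.trace_smul, smul_eq_mul]
        ring }
  refine ⟨χ.toHomUnits, ?_⟩
  ext x
  rw [weightSpace, Submodule.mem_iInf]
  change x ∈ Module.End.eigenspace (Matrix.toLin' (rotM (sheis s v) (sheis t w))) (-1) ↔ _
  rw [mem_eigenspace_rotM_neg_one, ← hP]
  constructor
  · intro hx y
    rw [Module.End.mem_eigenspace_iff, Matrix.toLin'_apply]
    nth_rewrite 1 [← hx]
    rw [Matrix.mulVec_mulVec, hscal y, Matrix.smul_mulVec, hx]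
    rfl
  · intro hx
    have key : ∀ (u : C) (ε : ZMod 2), coord u ∈ Submodule.span (ZMod 2) {coord v, coord w} →
        sheis ε u * P = -P → sheis ε u *ᵥ x = -x := by
      intro u ε hu hε
      have h1 := hx ⟨hElt u, hu⟩
      rw [Module.End.mem_eigenspace_iff, Matrix.toLin'_apply] at h1
      have h2 : ((χ.toHomUnits ⟨hElt u, hu⟩ : ℝˣ) : ℝ) = -sgn ℝ ε := by
        change (mat (hElt u) * P).trace / 2 = _
        rw [mat_hElt, sheis_eq ε, Matrix.smul_mul, hε, Matrix.trace_smul, Matrix.trace_neg, htr,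
          smul_eq_mul]
        ring
      rw [h2] at h1
      change mat (hElt u) *ᵥ x = _ at h1
      rw [mat_hElt] at h1
      rw [sheis, Matrix.smul_mulVec, h1, smul_smul, mul_neg, sgn_mul_self, neg_one_smul]
    rw [projM_mulVec_eq_iff ha hb hab]
    exact ⟨key v s (Submodule.subset_span (by simp)) (mul_projM_left ha),
      key w t (Submodule.subset_span (by simp)) (mul_projM_right hb hab)⟩

/-- The character takes values `±1` on a basis of the plane, and these are the signs. An orthogonal
involution is symmetric, hence determined by its `(-1)`-eigenspace, so it suffices to compare
eigenspaces. -/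
theorem exists_eq_lineRot {r : SO8} (hr : r ∈ R₂) :
    ∃ v w, ∃ h : IsLine v w, ∃ s t, r = lineRot h s t := by
  obtain ⟨hord, hne, S, hS, hfin, χ, hU⟩ := hr
  have hr2 : (r : Matrix Idx Idx ℝ) * r = 1 := by
    have : r * r = 1 := by
      rw [← pow_two, ← orderOf_dvd_iff_pow_eq_one, hord]
    exact congrArg Subtype.val this
  have hrT : (r : Matrix Idx Idx ℝ)ᵀ = r := by
    rw [← Matrix.one_mul (r : Matrix Idx Idx ℝ)ᵀ, ← hr2, Matrix.mul_assoc, coe_mul_transpose,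
      Matrix.mul_one]
  let e := Module.finBasisOfFinrankEq (ZMod 2) S hfin
  obtain ⟨v, hv⟩ := coord.surjective (e 0 : A)
  obtain ⟨w, hw⟩ := coord.surjective (e 1 : A)
  have hvS : coord v ∈ S := hv ▸ (e 0).2
  have hwS : coord w ∈ S := hw ▸ (e 1).2
  have hqv : quad v = 0 := by rw [← Q_coord]; exact hS _ hvS
  have hqw : quad w = 0 := by rw [← Q_coord]; exact hS _ hwS
  have h : IsLine v w := by
    refine ⟨?_, ?_, ?_, hqv, hqw, ?_⟩
    · rintro rfl
      rw [map_zero] at hv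
      exact e.ne_zero 0 (Subtype.ext hv.symm)
    · rintro rfl
      rw [map_zero] at hw
      exact e.ne_zero 1 (Subtype.ext hw.symm)
    · rintro rfl
      exact absurd (e.injective (Subtype.ext (hv.symm.trans hw))) (by decide)
    · have := hS _ (S.add_mem hvS hwS)
      rwa [← map_add, Q_coord, quad_add, hqv, hqw, add_zero, zero_add] at this
  have hspan : S = Submodule.span (ZMod 2) {coord v, coord w} := by
    refine (Submodule.eq_of_le_of_finrank_eq ?_ ?_).symm
    · rw [Submodule.span_le]
      rintro x (rfl | rfl)
      · exact hvS
      · exact hwS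
    · rw [finrank_span_coord h, hfin]
  rw [hU] at hne
  obtain ⟨y, hy, hy0⟩ := Submodule.exists_mem_ne_zero_of_ne_bot hne
  have hweight : ∀ x ∈ weightSpace (preimage S) χ, ∀ u (hu : coord u ∈ S),
      heis ℝ u *ᵥ x = (χ ⟨hElt u, hu⟩ : ℝ) • x := by
    intro x hx u hu
    rw [weightSpace, Submodule.mem_iInf] at hx
    have := Module.End.mem_eigenspace_iff.1 (hx ⟨hElt u, hu⟩)
    change mat (hElt u) *ᵥ x = _ at this
    rwa [mat_hElt] at this
  -- For singular `u` the matrix `heis u` is an involution. The minus sign is chosen so that `sheis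
  -- s u` acts as `-1` on the weight space.
  have hsign : ∀ u (hu : coord u ∈ S), quad u = 0 → ∃ s : ZMod 2,
      (χ ⟨hElt u, hu⟩ : ℝ) = -sgn ℝ s := by
    intro u hu hq
    have h1 := hweight y hy u hu
    have h2 : (1 : ℝ) • y = ((χ ⟨hElt u, hu⟩ : ℝ) * χ ⟨hElt u, hu⟩) • y := by
      calc (1 : ℝ) • y = (heis ℝ u * heis ℝ u) *ᵥ y := by
            rw [heis_mul_self, hq, sgn_zero, one_smul, one_smul, Matrix.one_mulVec]
        _ = _ := by rw [← Matrix.mulVec_mulVec, h1, Matrix.mulVec_smul, h1, smul_smul]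
    have h3 : (χ ⟨hElt u, hu⟩ : ℝ) * χ ⟨hElt u, hu⟩ = 1 := (smul_left_injective ℝ hy0 h2).symm
    rcases mul_self_eq_one_iff.1 h3 with h4 | h4
    · exact ⟨1, by rw [h4, sgn_one, neg_neg]⟩
    · exact ⟨0, by rw [h4, sgn_zero]⟩
  obtain ⟨s, hs⟩ := hsign v hvS hqv
  obtain ⟨t, ht⟩ := hsign w hwS hqw
  have ha := sheis_mul_self (s := s) h.2.2.2.1
  have hb := sheis_mul_self (s := t) h.2.2.2.2.1
  have hab := sheis_mul_comm (s := s) (t := t) h.2.2.2.2.2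
  have hle : ∀ x ∈ weightSpace (preimage S) χ, projM (sheis s v) (sheis t w) *ᵥ x = x := by
    intro x hx
    rw [projM_mulVec_eq_iff ha hb hab]
    constructor
    · rw [sheis, Matrix.smul_mulVec, hweight x hx v hvS, hs, smul_smul, mul_neg, sgn_mul_self,
        neg_one_smul]
    · rw [sheis, Matrix.smul_mulVec, hweight x hx w hwS, ht, smul_smul, mul_neg, sgn_mul_self,
        neg_one_smul]
  refine ⟨v, w, h, s, t, Subtype.ext ?_⟩
  refine eq_of_eigenspace_neg_one_eq hrT (lineM_transpose h s t) hr2 (lineM_mul_self h s t) ?_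
  rw [hU]
  ext x
  rw [coe_lineRot, lineM, mem_eigenspace_rotM_neg_one]
  refine ⟨hle x, fun hx => ?_⟩
  rw [weightSpace, Submodule.mem_iInf]
  rintro ⟨z, hz⟩
  have hz' : cls z ∈ Submodule.span (ZMod 2) {coord v, coord w} := hspan ▸ hz
  obtain ⟨c, hc⟩ := exists_mat_mul_projM_eq_smul h s t hz'
  have hscal : ∀ x, projM (sheis s v) (sheis t w) *ᵥ x = x → mat z *ᵥ x = c • x := by
    intro x hx
    nth_rewrite 1 [← hx]
    rw [Matrix.mulVec_mulVec, hc, Matrix.smul_mulVec, hx]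
  -- `z` acts by one scalar on the whole image of the projection, and the nonzero weight vector `y`
  -- identifies that scalar with the value of `χ`.
  have h1 := hscal y (hle y hy)
  rw [weightSpace, Submodule.mem_iInf] at hy
  have h2 := Module.End.mem_eigenspace_iff.1 (hy ⟨z, hz⟩)
  rw [Matrix.toLin'_apply, h1] at h2
  rw [Module.End.mem_eigenspace_iff, Matrix.toLin'_apply, hscal x hx,
    smul_left_injective ℝ hy0 h2]


/-! ### The number of involutions -/

/-- On the `(-1)`-eigenspace of `a`, `-ab` agrees with `b`. This is the change of basis from `w` to
`v + w` in a plane. -/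
theorem rotM_neg_mul {a b : Matrix Idx Idx ℝ} (ha : a * a = 1) : rotM a (-(a * b)) = rotM a b := by
  rw [rotM, rotM, Matrix.mul_neg, ← Matrix.mul_assoc, ha, Matrix.one_mul]
  congr 1
  abel

theorem lineM_comm {v w : C} (h : IsLine v w) (s t : ZMod 2) :
    lineM v w s t = lineM w v t s :=
  rotM_comm (sheis_mul_comm h.2.2.2.2.2)

theorem exists_lineM_add_right {v w : C} (h : IsLine v w) (s t : ZMod 2) :
    ∃ r, lineM v w s t = lineM v (v + w) s r := by
  refine ⟨s + t + dot v.2 w.1 + 1, ?_⟩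
  rw [lineM, lineM, ← rotM_neg_mul (sheis_mul_self h.2.2.2.1), sheis_mul_sheis]
  congr 1
  rw [sheis, sheis, sgn_add _ _ 1, sgn_one, mul_neg_one, neg_smul]

theorem IsLine.symm {v w : C} (h : IsLine v w) : IsLine w v :=
  ⟨h.2.1, h.1, h.2.2.1.symm, h.2.2.2.2.1, h.2.2.2.1, pol_comm v w ▸ h.2.2.2.2.2⟩

theorem IsLine.add_right {v w : C} (h : IsLine v w) : IsLine v (v + w) := by
  refine ⟨h.1, add_ne_zero_of_isLine h, fun h0 => h.2.1 (left_eq_add.1 h0), h.2.2.2.1, ?_, ?_⟩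
  · rw [quad_add, h.2.2.2.1, h.2.2.2.2.1, h.2.2.2.2.2]
    rfl
  · rw [pol_add_right, pol_self, h.2.2.2.2.2, add_zero]

/-- Sorting the three nonzero vectors of the plane by code requires only exchanges and replacements
of `w` by `v + w`, under which the signs change accordingly. -/
theorem exists_lineM_eq_of_mem_lineReps {v w : C} (h : IsLine v w) (s t : ZMod 2) :
    ∃ p ∈ lineReps, ∃ s' t', lineM v w s t = lineM p.1 p.2 s' t' := by
  have key : ∀ {v w : C} (h : IsLine v w) (s t : ZMod 2), code v < code w →
      ∃ p ∈ lineReps, ∃ s' t', lineM v w s t = lineM p.1 p.2 s' t' := by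
    intro v w h s t hlt
    have hvvw : v + (v + w) = w := by rw [← add_assoc, C_add_self, zero_add]
    have hwvw : w + (v + w) = v := by rw [add_comm v, ← add_assoc, C_add_self, zero_add]
    have hne : ∀ x y : C, x ≠ y → code x ≠ code y := fun x y hxy => code_injective.ne hxy
    have h1 := hne _ _ h.add_right.2.2.1
    have h2 : code w ≠ code (v + w) := by
      rw [add_comm]
      exact hne _ _ h.symm.add_right.2.2.1
    rcases lt_or_gt_of_ne h2 with h2 | h2
    · exact ⟨(v, w), ⟨hlt, h2, h⟩, s, t, rfl⟩
    obtain ⟨r, hr⟩ := exists_lineM_add_right h s t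
    rcases lt_or_gt_of_ne h1 with h1 | h1
    · refine ⟨(v, v + w), ?_, s, r, hr⟩
      exact ⟨h1, by rwa [hvvw], h.add_right⟩
    · refine ⟨(v + w, v), ?_, r, s, hr.trans (lineM_comm h.add_right _ _)⟩
      refine ⟨h1, ?_, h.add_right.symm⟩
      change code v < code (v + w + v)
      rwa [add_comm, hvvw]
  rcases lt_or_gt_of_ne (code_injective.ne h.2.2.1) with hlt | hlt
  · exact key h s t hlt
  · rw [lineM_comm h]
    exact key h.symm t s hlt

/-! ### Recovering the plane and the signs from traces -/

theorem trace_sheis_mul_heis {v : C} (hv : quad v = 0) (s : ZMod 2) (u : C) :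
    (sheis s v * heis ℝ u).trace = if u = v then 8 * sgn ℝ s else 0 := by
  rw [sheis, Matrix.smul_mul, Matrix.trace_smul]
  split_ifs with h
  · rw [h, heis_mul_self, hv, sgn_zero, one_smul, Matrix.trace_one, smul_eq_mul, mul_comm]
    norm_num
  · rw [heis_mul, Matrix.trace_smul, trace_heis, if_neg fun h0 => h (CharTwo.add_eq_zero.1 h0).symm,
      smul_zero, smul_zero]

/-- The traces are the coefficients of the rotation in the Heisenberg basis, up to a common factor:
their support recovers the plane and their signs recover `s` and `t`. -/
theorem trace_lineM_mul_heis {v w : C} (h : IsLine v w) (s t : ZMod 2) {u : C} (hu : u ≠ 0) :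
    (lineM v w s t * heis ℝ u).trace = (if u = v then 4 * sgn ℝ s else 0) +
      (if u = w then 4 * sgn ℝ t else 0) -
      if u = v + w then 4 * sgn ℝ (s + t + dot v.2 w.1) else 0 := by
  rw [lineM, rotM, sheis_mul_sheis, Matrix.smul_mul, Matrix.trace_smul, Matrix.sub_mul,
    Matrix.add_mul, Matrix.add_mul, Matrix.trace_sub, Matrix.trace_add, Matrix.trace_add,
    trace_sheis_mul_heis h.2.2.2.1, trace_sheis_mul_heis h.2.2.2.2.1,
    trace_sheis_mul_heis h.add_right.2.2.2.2.1, Matrix.one_mul, trace_heis, if_neg hu, smul_eq_mul]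
  split_ifs <;> ring

theorem sgn_injective : Function.Injective (sgn ℝ) := by
  intro s t h
  rcases zmod_two_cases s with rfl | rfl <;> rcases zmod_two_cases t with rfl | rfl <;>
    first | rfl | (norm_num at h)

theorem eq_or_eq_of_trace_ne_zero {v w : C} (h : IsLine v w) {s t : ZMod 2} {u : C} (hu : u ≠ 0)
    (htr : (lineM v w s t * heis ℝ u).trace ≠ 0) : u = v ∨ u = w ∨ u = v + w := by
  by_contra! h'
  rw [trace_lineM_mul_heis h s t hu, if_neg h'.1, if_neg h'.2.1, if_neg h'.2.2] at htr
  norm_num at htr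

theorem trace_lineM_mul_heis_left {v w : C} (h : IsLine v w) (s t : ZMod 2) :
    (lineM v w s t * heis ℝ v).trace = 4 * sgn ℝ s := by
  rw [trace_lineM_mul_heis h s t h.1, if_pos rfl, if_neg h.2.2.1, if_neg h.add_right.2.2.1,
    add_zero, sub_zero]

theorem trace_lineM_mul_heis_right {v w : C} (h : IsLine v w) (s t : ZMod 2) :
    (lineM v w s t * heis ℝ w).trace = 4 * sgn ℝ t := by
  rw [lineM_comm h, trace_lineM_mul_heis_left h.symm]

theorem sgn_ne_zero (s : ZMod 2) : sgn ℝ s ≠ 0 := by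
  rcases zmod_two_cases s with rfl | rfl <;> simp

/-- The singular planes and signs are determined by the rotation. -/
theorem eq_of_lineM_eq {p q : C × C} (hp : p ∈ lineReps) (hq : q ∈ lineReps) {s t s' t' : ZMod 2}
    (heq : lineM p.1 p.2 s t = lineM q.1 q.2 s' t') : p = q ∧ s = s' ∧ t = t' := by
  obtain ⟨v, w⟩ := p
  obtain ⟨v', w'⟩ := q
  obtain ⟨h1, h2, h⟩ := hp
  obtain ⟨h1', h2', h'⟩ := hq
  dsimp only at *
  have key : ∀ {a b : C} {r r' : ZMod 2}, IsLine a b → lineM v w s t = lineM a b r r' →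
      a = v ∨ a = w ∨ a = v + w := by
    intro a b r r' hab hM
    refine eq_or_eq_of_trace_ne_zero h (s := s) (t := t) hab.1 ?_
    rw [hM, trace_lineM_mul_heis_left hab]
    exact mul_ne_zero four_ne_zero (sgn_ne_zero r)
  obtain ⟨r, hr⟩ := exists_lineM_add_right h' s' t'
  have k1 := key h' heq
  have k2 := key h'.symm (heq.trans (lineM_comm h' _ _))
  have k3 := key h'.add_right.symm ((heq.trans hr).trans (lineM_comm h'.add_right _ _))
  -- Both planes have the same three nonzero vectors; since both triples are listed in increasing
  -- order of codes, they agree term by term.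
  simp only [← code_injective.eq_iff (a := v'), ← code_injective.eq_iff (a := w'),
    ← code_injective.eq_iff (a := v' + w')] at k1 k2 k3
  obtain rfl : v = v' := code_injective (by omega)
  obtain rfl : w = w' := code_injective (by omega)
  have e1 := trace_lineM_mul_heis_left h s t
  have e2 := trace_lineM_mul_heis_right h s t
  rw [heq, trace_lineM_mul_heis_left h] at e1
  rw [heq, trace_lineM_mul_heis_right h] at e2
  exact ⟨rfl, sgn_injective (by linarith), sgn_injective (by linarith)⟩

/-- 105 singular planes, each with four independent choices of two signs. -/
theorem ncard_R₂ : R₂.ncard = 420 := by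
  let f : (C × C) × (ZMod 2 × ZMod 2) → Matrix Idx Idx ℝ :=
    fun p => lineM p.1.1 p.1.2 p.2.1 p.2.2
  have himg : Subtype.val '' R₂ = f '' (lineReps ×ˢ Set.univ) := by
    ext M
    constructor
    · rintro ⟨r, hr, rfl⟩
      obtain ⟨v, w, h, s, t, rfl⟩ := exists_eq_lineRot hr
      obtain ⟨p, hp, s', t', e⟩ := exists_lineM_eq_of_mem_lineReps h s t
      exact ⟨(p, (s', t')), ⟨hp, trivial⟩, e.symm⟩
    · rintro ⟨⟨p, s, t⟩, hp, rfl⟩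
      exact ⟨_, lineRot_mem_R₂ hp.1.2.2 s t, rfl⟩
  rw [← Set.ncard_image_of_injective R₂ Subtype.val_injective, himg, Set.InjOn.ncard_image,
    Set.ncard_prod, ncard_lineReps, Set.ncard_univ, Nat.card_prod, Nat.card_zmod]
  rintro ⟨p, s, t⟩ hp ⟨q, s', t'⟩ hq e
  obtain ⟨rfl, rfl, rfl⟩ := eq_of_lineM_eq hp.1 hq.1 e
  rfl

/-! ### The action of the rotations on `A` -/

theorem exists_sheis_eq_smul_heis_add (v w : C) : ∃ s, heis ℝ v * heis ℝ w = sheis s (v + w) :=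
  ⟨_, heis_mul ℝ v w⟩

theorem exists_lineM_mul_heis {v w : C} (h : IsLine v w) (s t : ZMod 2) (u : C) :
    ∃ r, lineM v w s t * heis ℝ u = sheis r (siegelC v w u) * lineM v w s t := by
  have ha := sheis_mul_self (s := s) h.2.2.2.1
  have hb := sheis_mul_self (s := t) h.2.2.2.2.1
  have hab := sheis_mul_comm (s := s) (t := t) h.2.2.2.2.2
  have hu : heis ℝ u = sheis 0 u := by rw [sheis, sgn_zero, one_smul]
  have hv := heis_mul_sheis u v s
  have hw := heis_mul_sheis u w t
  rw [siegelC]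
  rcases zmod_two_cases (pol u v) with h1 | h1 <;> rcases zmod_two_cases (pol u w) with h2 | h2 <;>
    simp only [h1, h2, sgn_zero, sgn_one, one_smul, neg_one_smul, zero_smul, add_zero] at hv hw ⊢
  · exact ⟨0, by rw [← hu]; exact rotM_mul_eq_of_comm _ hv hw⟩
  · refine ⟨s + 0 + dot v.2 u.1, ?_⟩
    rw [lineM, rotM_mul_eq_of_anticomm_right ha hab _ hv hw, hu, sheis_mul_sheis, add_comm v u]
  · refine ⟨t + 0 + dot w.2 u.1, ?_⟩
    rw [lineM, rotM_mul_eq_of_anticomm_left hb hab _ hv hw, hu, sheis_mul_sheis, add_comm w u]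
  · refine ⟨s + t + dot v.2 w.1 + 0 + dot (v + w).2 u.1 + 1, ?_⟩
    rw [lineM, rotM_mul_eq_of_anticomm ha hb hab _ hv hw, hu, sheis_mul_sheis, sheis_mul_sheis,
      ← Matrix.neg_mul]
    congr 1
    rw [sheis, sheis, sgn_add _ _ 1, sgn_one, mul_neg_one, neg_smul,
      show u + w + v = v + w + u by abel]

theorem lineRot_inv {v w : C} (h : IsLine v w) (s t : ZMod 2) :
    (lineRot h s t)⁻¹ = lineRot h s t :=
  inv_eq_of_mul_eq_one_left (lineRot_mul_self h s t)

theorem exists_lineRot_conj {v w : C} (h : IsLine v w) (s t : ZMod 2) (u : C) :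
    ∃ r, (lineRot h s t : Matrix Idx Idx ℝ) * heis ℝ u *
      (((lineRot h s t)⁻¹ : SO8) : Matrix Idx Idx ℝ) = sheis r (siegelC v w u) := by
  obtain ⟨r, hr⟩ := exists_lineM_mul_heis h s t u
  exact ⟨r, by rw [lineRot_inv, coe_lineRot, hr, Matrix.mul_assoc, lineM_mul_self h,
    Matrix.mul_one]⟩

theorem lineRot_mem_N {v w : C} (h : IsLine v w) (s t : ZMod 2) : lineRot h s t ∈ N := by
  have key : ∀ g ∈ H, lineRot h s t * g * (lineRot h s t)⁻¹ ∈ H := by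
    intro g hg
    obtain ⟨u, r, hu⟩ := exists_mat_eq ⟨g, hg⟩
    obtain ⟨r', hr'⟩ := exists_lineRot_conj h s t u
    refine mem_H_of_eq_smul_heis (s := r + r') (v := siegelC v w u) ?_
    change (lineRot h s t : Matrix Idx Idx ℝ) * mat ⟨g, hg⟩ *
      (((lineRot h s t)⁻¹ : SO8) : Matrix Idx Idx ℝ) = _
    rw [hu, Matrix.mul_smul, Matrix.smul_mul, hr', sheis, smul_smul, sgn_add]
  rw [Subgroup.mem_normalizer_iff]
  refine fun g => ⟨key g, fun hg => ?_⟩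
  have := key _ hg
  rw [lineRot_inv] at this
  rwa [mul_assoc, mul_assoc, lineRot_mul_self, mul_one, ← mul_assoc, lineRot_mul_self,
    one_mul] at this

theorem act_lineRot {v w : C} (h : IsLine v w) (s t : ZMod 2) (c : C) :
    (act ⟨lineRot h s t, lineRot_mem_N h s t⟩ : A ≃ₗ[ZMod 2] A) (coord c) =
      coord (siegelC v w c) := by
  change cls (conj _ (hElt c)) = _
  rw [cls_eq_coord', mat_conj, mat_hElt]
  exact exists_lineRot_conj h s t c

/-! ### The group generated by the involutions -/

/-- The `(-1)`-eigenspaces of the two factors are the two halves, with `b = -1` and `b = 1`, of the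
`(-1)`-eigenspace of `a`; the product is therefore `a` itself. -/
theorem lineM_mul_lineM {v w : C} (h : IsLine v w) (s t : ZMod 2) :
    lineM v w s t * lineM v w s (t + 1) = sheis s v := by
  have ha := sheis_mul_self (s := s) h.2.2.2.1
  have hb := sheis_mul_self (s := t) h.2.2.2.2.1
  have hab := sheis_mul_comm (s := s) (t := t) h.2.2.2.2.2
  have hneg : sheis (t + 1) w = -sheis t w := by
    rw [sheis, sheis, sgn_add _ _ 1, sgn_one, mul_neg_one, neg_smul]
  rw [lineM, lineM, hneg]
  generalize sheis s v = a at *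
  generalize sheis t w = b at *
  have h1 : b * (a * b) = a := by rw [hab, ← mul_assoc, hb, one_mul]
  have h2 : a * (a * b) = b := by rw [← mul_assoc, ha, one_mul]
  have h3 : a * b * a = b := by rw [hab, mul_assoc, ha, mul_one]
  have h4 : a * b * b = a := by rw [mul_assoc, hb, mul_one]
  have h5 : a * b * (a * b) = 1 := by rw [mul_assoc, h1, ha]
  simp only [rotM, Matrix.smul_mul, Matrix.mul_smul, mul_add, mul_sub, add_mul, sub_mul, mul_neg,
    h1, h2, h3, h4, h5, ha, hb, ← hab, mul_one, one_mul]
  module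

theorem exists_isLine {v : C} (hv : v ≠ 0) (hq : quad v = 0) : ∃ w, IsLine v w := by
  obtain ⟨w, hw, hqw, hvw, -, hp, -⟩ := exists_orthogonal_singular v v
  exact ⟨w, hv, hw, hvw, hq, hqw, hp⟩

/-- `lineM_mul_lineM` gives both signs for every nonzero singular vector, and every vector is a sum
of two singular ones, one in each half of `C`. -/
theorem exists_mem_closure_eq_sheis (v : C) (s : ZMod 2) :
    ∃ g ∈ Subgroup.closure R₂, (g : Matrix Idx Idx ℝ) = sheis s v := by
  have hsing : ∀ v, v ≠ 0 → quad v = 0 → ∀ s,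
      ∃ g ∈ Subgroup.closure R₂, (g : Matrix Idx Idx ℝ) = sheis s v := by
    intro v hv hq s
    obtain ⟨w, h⟩ := exists_isLine hv hq
    exact ⟨lineRot h s 0 * lineRot h s (0 + 1), Subgroup.mul_mem _
      (Subgroup.subset_closure (lineRot_mem_R₂ h _ _))
      (Subgroup.subset_closure (lineRot_mem_R₂ h _ _)), lineM_mul_lineM h s 0⟩
  have hadd : ∀ v w, (∀ s, ∃ g ∈ Subgroup.closure R₂, (g : Matrix Idx Idx ℝ) = sheis s v) →
      (∀ s, ∃ g ∈ Subgroup.closure R₂, (g : Matrix Idx Idx ℝ) = sheis s w) →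
      ∀ s, ∃ g ∈ Subgroup.closure R₂, (g : Matrix Idx Idx ℝ) = sheis s (v + w) := by
    intro v w hv hw s
    obtain ⟨g, hg, eg⟩ := hv (s + dot v.2 w.1)
    obtain ⟨k, hk, ek⟩ := hw 0
    refine ⟨g * k, Subgroup.mul_mem _ hg hk, ?_⟩
    change (g : Matrix Idx Idx ℝ) * (k : Matrix Idx Idx ℝ) = _
    rw [eg, ek, sheis_mul_sheis, add_zero, add_assoc, CharTwo.add_self_eq_zero, add_zero]
  have hzero : ∀ s, ∃ g ∈ Subgroup.closure R₂, (g : Matrix Idx Idx ℝ) = sheis s 0 := by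
    have h := hsing (((1, 0, 0), 0) : C) (by decide) (by decide)
    have := hadd _ _ h h
    rwa [C_add_self] at this
  have hsing' : ∀ v, quad v = 0 → ∀ s,
      ∃ g ∈ Subgroup.closure R₂, (g : Matrix Idx Idx ℝ) = sheis s v := by
    intro v hq
    by_cases hv : v = 0
    · exact hv ▸ hzero
    · exact hsing v hv hq
  have hv : v = (v.1, 0) + (0, v.2) := by simp
  rw [hv]
  exact hadd _ _ (hsing' _ (by simp [quad, dot])) (hsing' _ (by simp [quad, dot])) s

theorem H_le_closure : H ≤ Subgroup.closure R₂ := by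
  intro g hg
  obtain ⟨v, s, hv⟩ := exists_mat_eq ⟨g, hg⟩
  obtain ⟨k, hk, ek⟩ := exists_mem_closure_eq_sheis v s
  have : g = k := Subtype.ext (hv.trans ek.symm)
  exact this ▸ hk


/-! ### The group `L` -/

/-- The preimage in `N` of the special orthogonal group `O⁺(Q)`. -/
noncomputable def rotGroup : Subgroup SO8 := (slHom.range.comap act).map N.subtype

theorem mem_rotGroup {g : SO8} : g ∈ rotGroup ↔ ∃ h : g ∈ N, act ⟨g, h⟩ ∈ slHom.range := by
  constructor
  · rintro ⟨n, hn, rfl⟩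
    exact ⟨n.2, hn⟩
  · rintro ⟨h, hg⟩
    exact ⟨⟨g, h⟩, hg, rfl⟩

/-- The generated group and the preimage have the same image in `O(Q)`, because the involutions
induce the Siegel transformations generating the image of `SL₄(2)`. Both contain the kernel of the
action, as it lies in `H`. -/
theorem closure_R₂ : Subgroup.closure R₂ = rotGroup := by
  have hle : Subgroup.closure R₂ ≤ rotGroup := by
    rw [Subgroup.closure_le]
    intro r hr
    obtain ⟨v, w, h, s, t, rfl⟩ := exists_eq_lineRot hr
    exact mem_rotGroup.2 ⟨lineRot_mem_N h s t,
      mem_range_slHom.2 (dicksonInvariant_of_siegelC h (act_lineRot h s t))⟩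
  refine le_antisymm hle ?_
  rintro _ ⟨n, hn, rfl⟩
  have hS : slHom.range ≤ ((Subgroup.closure R₂).comap N.subtype).map act := by
    refine range_slHom_le fun v w h u hu => ?_
    refine ⟨⟨lineRot h 0 0, lineRot_mem_N h 0 0⟩,
      Subgroup.subset_closure (lineRot_mem_R₂ h 0 0), ?_⟩
    refine Subtype.ext (LinearEquiv.ext fun x => ?_)
    obtain ⟨c, rfl⟩ := coord.surjective x
    rw [act_lineRot, hu]
  obtain ⟨k, hk, hkn⟩ := hS hn
  have h1 : ((k⁻¹ * n : N) : SO8) ∈ H :=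
    mem_H_of_act_eq_one _ (by rw [map_mul, map_inv, hkn, inv_mul_cancel])
  have h2 := Subgroup.mul_mem (Subgroup.closure R₂) (x := (k : SO8)) hk (H_le_closure h1)
  have h3 : (k : SO8) * ((k⁻¹ * n : N) : SO8) = n := by simp
  rwa [h3] at h2

theorem H_le_rotGroup : H ≤ rotGroup := closure_R₂ ▸ H_le_closure

instance : Finite (orthogonalGroup Q) :=
  Finite.of_injective (fun u : orthogonalGroup Q => ((u : A ≃ₗ[ZMod 2] A) : A → A))
    fun _ _ h => Subtype.ext (DFunLike.coe_injective h)

/-- The kernel of `act` embeds in the finite group `H` and the quotient by it embeds in `O(Q)`. -/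
instance : Finite N := by
  have : Finite act.ker := Finite.of_injective
    (fun n : act.ker => (⟨n, mem_H_of_act_eq_one n n.2⟩ : H)) fun _ _ h =>
      Subtype.ext (Subtype.ext (congrArg (fun x : H => (x : SO8)) h))
  have : Finite (N ⧸ act.ker) :=
    Finite.of_injective _ (QuotientGroup.kerLift_injective act)
  exact Finite.of_equiv _ (Subgroup.groupEquivQuotientProdSubgroup (s := act.ker)).symm

instance : Finite rotGroup := Finite.of_injective
  (fun g : rotGroup => (⟨g, (mem_rotGroup.1 g.2).1⟩ : N)) fun _ _ h =>
    Subtype.ext (congrArg (fun x : N => (x : SO8)) h)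

theorem isRotation_of_mem_R₂ {r : SO8} (hr : r ∈ R₂) : IsRotation r := by
  obtain ⟨v, w, h, s, t, rfl⟩ := exists_eq_lineRot hr
  exact isRotation_lineRot h s t

theorem isRotationGroup_rotGroup : IsRotationGroup rotGroup := by
  refine ⟨inferInstance, le_antisymm ((Subgroup.closure_le _).2 fun g hg => hg.1) ?_⟩
  conv_lhs => rw [← closure_R₂]
  exact Subgroup.closure_mono fun r hr =>
    ⟨closure_R₂ ▸ Subgroup.subset_closure hr, isRotation_of_mem_R₂ hr⟩

/-! ### Absolute irreducibility -/

theorem isAbsolutelyIrreducible_rotGroup : IsAbsolutelyIrreducible rotGroup := by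
  have key : ∀ σ : Subrepresentation (complexification rotGroup), σ = ⊥ ∨ σ = ⊤ := by
    intro σ
    have := eq_bot_or_eq_top_of_heis ℂ σ.toSubmodule fun v x hx => by
      have h := σ.apply_mem_toSubmodule
        (⟨(hElt v : SO8), H_le_rotGroup (hElt v).2⟩ : rotGroup) hx
      change ((mat (hElt v)).map (algebraMap ℝ ℂ)) *ᵥ x ∈ _ at h
      rwa [mat_hElt, map_heis] at h
    rcases this with h | h
    · left
      exact Subrepresentation.toSubmodule_injective h
    · right
      exact Subrepresentation.toSubmodule_injective h
  have : Nontrivial (Subrepresentation (complexification rotGroup)) := by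
    refine ⟨⊥, ⊤, fun h => ?_⟩
    exact bot_ne_top (α := Submodule ℂ (Idx → ℂ)) (congrArg Subrepresentation.toSubmodule h)
  unfold IsAbsolutelyIrreducible
  exact ⟨key⟩


/-! ### Primitivity -/

/-- The image of a subspace under a matrix. -/
noncomputable def mulMap (M : Matrix Idx Idx ℝ) (X : Submodule ℝ (Idx → ℝ)) :
    Submodule ℝ (Idx → ℝ) := X.map (Matrix.toLin' M)

theorem mulMap_mul (M M' : Matrix Idx Idx ℝ) (X : Submodule ℝ (Idx → ℝ)) :
    mulMap (M * M') X = mulMap M (mulMap M' X) := by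
  rw [mulMap, Matrix.toLin'_mul, Submodule.map_comp]
  rfl

theorem mulMap_one (X : Submodule ℝ (Idx → ℝ)) : mulMap 1 X = X := by
  rw [mulMap, Matrix.toLin'_one, Submodule.map_id]

/-- Signs are invisible on subspaces, so the Heisenberg matrices act on subspaces through the
abelian group `C`. -/
theorem mulMap_sheis (s : ZMod 2) (v : C) : mulMap (sheis s v) = mulMap (heis ℝ v) := by
  funext X
  rw [mulMap, sheis, map_smul, Submodule.map_smul _ _ _ (sgn_ne_zero s)]
  rfl

theorem mulMap_heis_add (v w : C) (X : Submodule ℝ (Idx → ℝ)) :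
    mulMap (heis ℝ (v + w)) X = mulMap (heis ℝ v) (mulMap (heis ℝ w) X) := by
  obtain ⟨s, hs⟩ := exists_sheis_eq_smul_heis_add v w
  rw [← mulMap_mul, hs, mulMap_sheis]

theorem mulMap_heis_self (v : C) (X : Submodule ℝ (Idx → ℝ)) :
    mulMap (heis ℝ v) (mulMap (heis ℝ v) X) = X := by
  rw [← mulMap_heis_add, C_add_self, heis_zero, mulMap_one]

theorem mulMap_heis_comm (v w : C) (X : Submodule ℝ (Idx → ℝ)) :
    mulMap (heis ℝ v) (mulMap (heis ℝ w) X) = mulMap (heis ℝ w) (mulMap (heis ℝ v) X) := by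
  rw [← mulMap_heis_add, add_comm, mulMap_heis_add]

theorem mulMap_heis_siegelC {v w : C} (h : IsLine v w) (u : C) (X : Submodule ℝ (Idx → ℝ)) :
    mulMap (heis ℝ (siegelC v w u)) (mulMap (lineM v w 0 0) X) =
      mulMap (lineM v w 0 0) (mulMap (heis ℝ u) X) := by
  obtain ⟨r, hr⟩ := exists_lineM_mul_heis h 0 0 u
  rw [← mulMap_mul (lineM v w 0 0), hr, mulMap_mul, mulMap_sheis]

theorem mulMap_lineM_self {v w : C} (h : IsLine v w) (X : Submodule ℝ (Idx → ℝ)) :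
    mulMap (lineM v w 0 0) (mulMap (lineM v w 0 0) X) = X := by
  rw [← mulMap_mul, lineM_mul_self h, mulMap_one]

theorem eq_bot_or_eq_top_of_mulMap {X : Submodule ℝ (Idx → ℝ)}
    (h : ∀ v, mulMap (heis ℝ v) X ≤ X) : X = ⊥ ∨ X = ⊤ :=
  eq_bot_or_eq_top_of_heis ℝ X fun v x hx => h v ⟨x, hx, rfl⟩

/-- A nonzero additive subgroup that is stable under the Siegel transformations is everything. -/
theorem eq_top_of_siegelC_mem {K : AddSubgroup C} {k : C} (hk : k ∈ K) (hk0 : k ≠ 0)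
    (hK : ∀ v w, IsLine v w → ∀ u ∈ K, siegelC v w u ∈ K) : K = ⊤ := by
  have step : ∀ x ∈ K, ∀ y, x ≠ 0 → x ≠ y → y ≠ 0 → quad y = 0 → pol x y = 0 → y ∈ K := by
    intro x hx y h1 h2 h3 h4 h5
    obtain ⟨a, ha, hxa⟩ := exists_line_of_orthogonal x y h1 h2 h3 h4 h5
    -- Here `siegelC a y x = x + y`, so adding `x` leaves `y`.
    have h6 := K.add_mem hx (hK a y ha x hx)
    rwa [siegelC, hxa, h5, one_smul, zero_smul, add_zero, ← add_assoc, C_add_self, zero_add] at h6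
  have hsing : ∀ y, quad y = 0 → y ∈ K := by
    intro y hy
    by_cases hy0 : y = 0
    · exact hy0 ▸ K.zero_mem
    · obtain ⟨s, hs0, hs, hks, hsy, h1, h2⟩ := exists_orthogonal_singular k y
      exact step s (step k hk s hk0 hks hs0 hs h1) y hs0 hsy hy0 hy h2
  refine eq_top_iff.2 fun v _ => ?_
  have hv : v = (v.1, 0) + (0, v.2) := by simp
  rw [hv]
  exact K.add_mem (hsing _ (by simp [quad, dot])) (hsing _ (by simp [quad, dot]))

theorem card_C : Fintype.card C = 64 := by simp [ZMod.card]

theorem isPrimitive_rotGroup : IsPrimitive rotGroup := by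
  rintro ⟨l, V, hV, hne, hperm⟩
  have hheis : ∀ u i, ∃ j, mulMap (heis ℝ u) (V i) = V j := by
    intro u i
    obtain ⟨j, hj⟩ := hperm _ (H_le_rotGroup (hElt u).2) i
    change mulMap (mat (hElt u)) (V i) = V j at hj
    exact ⟨j, by rwa [mat_hElt] at hj⟩
  have hline : ∀ v w, IsLine v w → ∀ i, ∃ j, mulMap (lineM v w 0 0) (V i) = V j :=
    fun v w h => hperm (lineRot h 0 0)
      (closure_R₂ ▸ Subgroup.subset_closure (lineRot_mem_R₂ h 0 0))
  have hl : l ≤ 8 := by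
    have h1 := hV.submodule_iSupIndep.subtype_ne_bot_le_finrank
    have h2 : Fintype.card {i // V i ≠ ⊥} = l := by
      rw [Fintype.card_congr (Equiv.subtypeUnivEquiv fun i => (hne i).1), Fintype.card_fin]
    rw [h2] at h1
    simpa using h1
  obtain ⟨i₀⟩ : Nonempty (Fin l) := by
    by_contra h
    rw [not_nonempty_iff] at h
    have h1 := hV.submodule_iSup_eq_top
    rw [iSup_of_empty] at h1
    exact bot_ne_top h1
  choose j hj using fun u => hheis u i₀
  -- Independent nonzero blocks number at most 8, fewer than the 64 elements of `C`: two of these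
  -- send `V i₀` to the same block, so their sum stabilizes it.
  obtain ⟨u, u', huu, hjj⟩ := Fintype.exists_ne_map_eq_of_card_lt j (by
    rw [card_C, Fintype.card_fin]
    omega)
  have hk : mulMap (heis ℝ (u + u')) (V i₀) = V i₀ := by
    rw [mulMap_heis_add, hj, ← hjj, ← hj, mulMap_heis_self]
  -- `H` is transitive on blocks: the translates of `V i₀` span an invariant nonzero subspace, which
  -- is everything. A block that is not a translate would lie in the sum of the others,
  -- contradicting independence.
  have hblock : ∀ i, ∃ w, V i = mulMap (heis ℝ w) (V i₀) := by
    intro i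
    by_contra! hi
    have htop : ⨆ w, mulMap (heis ℝ w) (V i₀) = ⊤ := by
      refine (eq_bot_or_eq_top_of_mulMap fun v => ?_).resolve_left fun h0 => (hne i₀).1 ?_
      · rw [mulMap, Submodule.map_iSup]
        refine iSup_le fun w => le_iSup_of_le (v + w) ?_
        rw [mulMap_heis_add]
        rfl
      · rw [eq_bot_iff, ← h0]
        refine le_iSup_of_le 0 ?_
        rw [heis_zero, mulMap_one]
    have hle : (⊤ : Submodule ℝ (Idx → ℝ)) ≤ ⨆ (m) (_ : m ≠ i), V m := by
      rw [← htop]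
      refine iSup_le fun w => ?_
      rw [hj]
      exact le_iSup₂_of_le (j w) (fun h => hi w (by rw [hj, h])) le_rfl
    have hdis := hV.submodule_iSupIndep i
    rw [top_le_iff.1 hle, disjoint_top] at hdis
    exact (hne i).1 hdis
  -- The kernel of the action of `C` on the set of blocks. By transitivity and commutativity it
  -- contains every stabilizer of a single block.
  let K : AddSubgroup C :=
    { carrier := {v | ∀ i, mulMap (heis ℝ v) (V i) = V i}
      zero_mem' := fun i => by rw [heis_zero, mulMap_one]
      add_mem' := fun {v w} hv hw i => by rw [mulMap_heis_add, hw, hv]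
      neg_mem' := fun {v} hv i => by rw [CharTwo.neg_eq, hv] }
  have hkK : u + u' ∈ K := by
    intro i
    obtain ⟨w, hw⟩ := hblock i
    rw [hw, mulMap_heis_comm, hk]
  have hK : K = ⊤ := by
    -- The rotations permute the blocks and conjugate Heisenberg matrices by Siegel transformations,
    -- so `K` is stable under the latter.
    refine eq_top_of_siegelC_mem hkK (fun h0 => huu (CharTwo.add_eq_zero.1 h0)) ?_
    intro v w h x hx i
    obtain ⟨m, hm⟩ := hline v w h i
    rw [← mulMap_lineM_self h (V i), hm, mulMap_heis_siegelC h, hx]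
  have hinv : ∀ v, mulMap (heis ℝ v) (V i₀) ≤ V i₀ := fun v =>
    ((hK ▸ AddSubgroup.mem_top v : v ∈ K) i₀).le
  exact (eq_bot_or_eq_top_of_mulMap hinv).elim (hne i₀).1 (hne i₀).2

end ExoticRotationGroup

theorem proposition4p13 :
    ∃ (Oplus : Subgroup (ExoticRotationGroup.orthogonalGroup ExoticRotationGroup.Q))
      (L : Subgroup ExoticRotationGroup.SO8),
      (∀ u, u ∈ Oplus ↔ ExoticRotationGroup.dicksonInvariant u = 0) ∧
      Nonempty (Oplus ≃* Matrix.SpecialLinearGroup (Fin 4) (ZMod 2)) ∧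
      L = (Oplus.comap ExoticRotationGroup.act).map ExoticRotationGroup.N.subtype ∧
      ExoticRotationGroup.IsRotationGroup L ∧
      ExoticRotationGroup.R₂.ncard = 420 ∧
      (∀ r ∈ ExoticRotationGroup.R₂, ExoticRotationGroup.IsRotation r ∧ orderOf r = 2) ∧
      Subgroup.closure ExoticRotationGroup.R₂ = L ∧
      ExoticRotationGroup.IsPrimitive L ∧
      ExoticRotationGroup.IsAbsolutelyIrreducible L := by
  open ExoticRotationGroup in
  exact ⟨slHom.range, rotGroup, fun _ => mem_range_slHom,
    ⟨(MonoidHom.ofInjective slHom_injective).symm⟩, rfl, isRotationGroup_rotGroup, ncard_R₂,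
    fun r hr => ⟨isRotation_of_mem_R₂ hr, hr.1⟩, closure_R₂, isPrimitive_rotGroup,
    isAbsolutelyIrreducible_rotGroup⟩
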